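/- **Proposition (Deduction and Lifting Base).** We consider first-order logic without equality; $\models$ refers to structures with nonempty domain. $\mathrm{fun}(A)$ is the set of function symbols (constants included, as $0$-ary symbols) occurring in $A$, and $\mathrm{pred}^{\pm}(A)$ is the set of pairs $\pm p$ such that predicate $p$ occurs in $A$ with that polarity. A *Craig-Lyndon interpolant* for $A, B$, where $A \models B$, is a formula $H$ with $A \models H$, $H \models B$, $\mathrm{pred}^\pm(H) \subseteq \mathrm{pred}^\pm(A) \cap \mathrm{pred}^\pm(B)$, $\mathrm{fun}(H) \subseteq \mathrm{fun}(A) \cap \mathrm{fun}(B)$, and every free variable of $H$ free in both $A$ and $B$. An *interpolant lifting base* is a tuple $\langle F, G, \bar f, \bar g, H\rangle$ where $F, G$ are first-order sentences, $\bar f, \bar g$ are disjoint finite sets of function symbols, and $H$ is a ground (quantifier-free and variable-free) formula, such that there are quantifier-free formulas $F_{\mathrm{exp}}(\bar u)$, $G_{\mathrm{exp}}(\bar v)$ with disjoint tuples of free variables $\bar u, \bar v$ and a ground substitution $\theta$ with domain $\bar u \cup \bar v$ with 1. $F \models \exists \bar f\, \forall \bar u\, F_{\mathrm{exp}}(\bar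 u)$ and $\forall \bar g\, \exists \bar v\, G_{\mathrm{exp}}(\bar v) \models G$ (second-order quantification over the symbols in $\bar f$, $\bar g$); 2. $\mathrm{pred}^\pm(F_{\mathrm{exp}}) \subseteq \mathrm{pred}^\pm(F)$ and $\mathrm{pred}^\pm(G_{\mathrm{exp}}) \subseteq \mathrm{pred}^\pm(G)$; 3. $\mathrm{fun}(F_{\mathrm{exp}}) \subseteq (\mathrm{fun}(F) \cap \mathrm{fun}(G)) \cup \bar f$ and $\mathrm{fun}(G_{\mathrm{exp}}) \subseteq (\mathrm{fun}(F) \cap \mathrm{fun}(G)) \cup \bar g$; 4. $\mathrm{fun}(F) \cap \bar g = \emptyset$ and $\mathrm{fun}(G) \cap \bar f = \emptyset$; 5. every function symbol in the range of $\theta$ is in $\mathrm{fun}(F_{\mathrm{exp}}) \cup \mathrm{fun}(G_{\mathrm{exp}}) \cup C$, where $C \subseteq \bar f \cup \bar g$ is empty or consists of a single constant $c_0$; 6. $H$ is a Craig-Lyndon interpolant for $F_{\mathrm{exp}}(\bar u)\theta$ and $G_{\mathrm{exp}}(\bar v)\theta$. Let $F, G$ be first-order sentences such that $F \models G$. Let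 the sets of clauses $F', G'$ be obtained from $F, \lnot G$, respectively, by prenexing, Skolemization and CNF transformation, where all the introduced Skolem functions are distinct and do not occur in $F$ or $G$. Let $\bar f$ be the union of the Skolem functions introduced for $F$ and $\mathrm{fun}(F) \setminus \mathrm{fun}(G)$, and let $\bar g$ be the union of the Skolem functions introduced for $\lnot G$ and $\mathrm{fun}(G) \setminus \mathrm{fun}(F)$. If there is no constant in $\bar f \cup \bar g \cup (\mathrm{fun}(F) \cap \mathrm{fun}(G))$, then add a fresh constant $c_0$ to either $\bar f$ or $\bar g$. Let $\mathcal{D}$ be a proof (a deduction of the empty clause) of $F' \cup G'$ by binary resolution and factoring, where clauses are multisets of literals. Let $\mathcal{D}_{\mathrm{grd}}$ be a ground proof (by ground resolution and merging of duplicate literals) for $\mathcal{D}$, that is, a ground proof obtained as follows: expand $\mathcal{D}$ into a deduction tree, whose leaves are fresh copies of input clauses and where the most general unifiers are applied to the whole tree; instantiate all variables of the tree by ground terms built from the function symbols in $\bar f \cup \bar g \cup (\mathrm{fun}(F) \cap \mathrm{fun}(G))$; convert the resulting ground deduction tree into a deduction (a sequence of clauses), where nodes with identical clauses may be shared. The input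 clauses of $\mathcal{D}_{\mathrm{grd}}$ are its members that are clauses of leaves of the ground tree. Let $F_{\mathrm{grd}}$ ($G_{\mathrm{grd}}$) be the set of the input clauses of $\mathcal{D}_{\mathrm{grd}}$ that are instances of clauses in $F'$ ($G'$), considered as a CNF formula. If $H_{\mathrm{grd}}$ is a ground formula that is a Craig-Lyndon interpolant for $F_{\mathrm{grd}}, \lnot G_{\mathrm{grd}}$, then $\langle F, G, \bar f, \bar g, H_{\mathrm{grd}}\rangle$ is an interpolant lifting base. -/

import Mathlib

universe u v w

namespace CraigLifting

variable {L : FirstOrder.Language.{u, v}}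

/-! ## Formulas of first-order logic without equality -/

/-- Formulas over `L`, without equality, whose free variables are among `x_0, …, x_{n-1}`.
The variable bound by a quantifier in front of a formula of `Fml L (n + 1)` is `x_n`. -/
inductive Fml (L : FirstOrder.Language.{u, v}) : ℕ → Type (max u v)
  | top {n : ℕ} : Fml L n
  | bot {n : ℕ} : Fml L n
  | atom {n k : ℕ} (R : L.Relations k) (ts : Fin k → L.Term (Fin n)) : Fml L n
  | neg {n : ℕ} (A : Fml L n) : Fml L n
  | and {n : ℕ} (A B : Fml L n) : Fml L n
  | or {n : ℕ} (A B : Fml L n) : Fml L n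
  | imp {n : ℕ} (A B : Fml L n) : Fml L n
  | iff {n : ℕ} (A B : Fml L n) : Fml L n
  | all {n : ℕ} (A : Fml L (n + 1)) : Fml L n
  | ex {n : ℕ} (A : Fml L (n + 1)) : Fml L n

/-- The type of function symbols of all arities; constants are the symbols of arity `0`. -/
abbrev FunSym (L : FirstOrder.Language.{u, v}) : Type u := Σ k : ℕ, L.Functions k

/-- The type of predicate symbols of all arities. -/
abbrev PredSym (L : FirstOrder.Language.{u, v}) : Type v := Σ k : ℕ, L.Relations k

/-- The function symbols that occur in a term. -/
def termFuns {α : Type} : L.Term α → Set (FunSym L)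
  | .var _ => ∅
  | .func (l := k) f ts => {⟨k, f⟩} ∪ ⋃ i, termFuns (ts i)

/-- The extension of a substitution to the scope of a quantifier. -/
def liftSubst {n m : ℕ} (σ : Fin n → L.Term (Fin m)) : Fin (n + 1) → L.Term (Fin (m + 1)) :=
  Fin.snoc (α := fun _ => L.Term (Fin (m + 1)))
    (fun i => (σ i).relabel Fin.castSucc) (.var (Fin.last m))

namespace Fml

/-- Capture-avoiding substitution of terms for the free variables. -/
def subst : {n m : ℕ} → Fml L n → (Fin n → L.Term (Fin m)) → Fml L m
  | _, _, top, _ => top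
  | _, _, bot, _ => bot
  | _, _, atom R ts, σ => atom R fun i => (ts i).subst σ
  | _, _, neg A, σ => neg (A.subst σ)
  | _, _, and A B, σ => and (A.subst σ) (B.subst σ)
  | _, _, or A B, σ => or (A.subst σ) (B.subst σ)
  | _, _, imp A B, σ => imp (A.subst σ) (B.subst σ)
  | _, _, iff A B, σ => iff (A.subst σ) (B.subst σ)
  | _, _, all A, σ => all (A.subst (liftSubst σ))
  | _, _, ex A, σ => ex (A.subst (liftSubst σ))

/-- A formula considered as a formula with one more, non-occurring, free variable `x_n`. -/
def weaken {n : ℕ} (A : Fml L n) : Fml L (n + 1) :=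
  A.subst fun i => .var i.castSucc

/-- The formula is quantifier-free. -/
def IsQF : {n : ℕ} → Fml L n → Prop
  | _, top => True
  | _, bot => True
  | _, atom _ _ => True
  | _, neg A => A.IsQF
  | _, and A B => A.IsQF ∧ B.IsQF
  | _, or A B => A.IsQF ∧ B.IsQF
  | _, imp A B => A.IsQF ∧ B.IsQF
  | _, iff A B => A.IsQF ∧ B.IsQF
  | _, all _ => False
  | _, ex _ => False

/-- The function symbols (including constants) that occur in a formula. -/
def funs : {n : ℕ} → Fml L n → Set (FunSym L)
  | _, top => ∅
  | _, bot => ∅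
  | _, atom _ ts => ⋃ i, termFuns (ts i)
  | _, neg A => A.funs
  | _, and A B => A.funs ∪ B.funs
  | _, or A B => A.funs ∪ B.funs
  | _, imp A B => A.funs ∪ B.funs
  | _, iff A B => A.funs ∪ B.funs
  | _, all A => A.funs
  | _, ex A => A.funs

/-- Auxiliary: the polarity-predicate pairs of a formula, itself regarded as an occurrence of
polarity `b` (`true` is positive, `false` is negative). -/
def predsAux : {n : ℕ} → Bool → Fml L n → Set (Bool × PredSym L)
  | _, _, top => ∅
  | _, _, bot => ∅
  | _, b, atom (k := k) R _ => {(b, ⟨k, R⟩)}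
  | _, b, neg A => A.predsAux (!b)
  | _, b, and A B => A.predsAux b ∪ B.predsAux b
  | _, b, or A B => A.predsAux b ∪ B.predsAux b
  | _, b, imp A B => A.predsAux (!b) ∪ B.predsAux b
  | _, b, iff A B => (A.predsAux b ∪ A.predsAux (!b)) ∪ (B.predsAux b ∪ B.predsAux (!b))
  | _, b, all A => A.predsAux b
  | _, b, ex A => A.predsAux b

/-- The set of the pairs `(polarity, predicate)` such that the predicate has an occurrence with
that polarity in the formula. -/
def preds {n : ℕ} (A : Fml L n) : Set (Bool × PredSym L) := A.predsAux true

/-- The free variables of a formula. -/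
def vars : {n : ℕ} → Fml L n → Set (Fin n)
  | _, top => ∅
  | _, bot => ∅
  | _, atom _ ts => ⋃ i, ((ts i).varFinset : Set _)
  | _, neg A => A.vars
  | _, and A B => A.vars ∪ B.vars
  | _, or A B => A.vars ∪ B.vars
  | _, imp A B => A.vars ∪ B.vars
  | _, iff A B => A.vars ∪ B.vars
  | _, all A => {i | i.castSucc ∈ A.vars}
  | _, ex A => {i | i.castSucc ∈ A.vars}

/-- Tarski's satisfaction relation, in the structure `I` on the carrier `M`. -/
def Sat {M : Type w} (I : L.Structure M) : {n : ℕ} → Fml L n → (Fin n → M) → Prop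
  | _, top, _ => True
  | _, bot, _ => False
  | _, atom R ts, x => I.RelMap R fun i => (ts i).realize x
  | _, neg A, x => ¬ A.Sat I x
  | _, and A B, x => A.Sat I x ∧ B.Sat I x
  | _, or A B, x => A.Sat I x ∨ B.Sat I x
  | _, imp A B, x => A.Sat I x → B.Sat I x
  | _, iff A B, x => A.Sat I x ↔ B.Sat I x
  | _, all A, x => ∀ a : M, A.Sat I (Fin.snoc (α := fun _ => M) x a)
  | _, ex A, x => ∃ a : M, A.Sat I (Fin.snoc (α := fun _ => M) x a)

/-- Entailment, over all structures with nonempty carrier (in the universe `w`) and all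
assignments of the free variables. -/
def Entails {n : ℕ} (A B : Fml L n) : Prop :=
  ∀ (M : Type w) [Nonempty M] (I : L.Structure M) (x : Fin n → M), A.Sat I x → B.Sat I x

end Fml

/-- `H` is a Craig-Lyndon interpolant for `A`, `B`. -/
structure IsCraigLyndon {n : ℕ} (A B H : Fml L n) : Prop where
  entails : Fml.Entails.{u, v, w} A B
  left : Fml.Entails.{u, v, w} A H
  right : Fml.Entails.{u, v, w} H B
  preds : H.preds ⊆ A.preds ∩ B.preds
  funs : H.funs ⊆ A.funs ∩ B.funs
  vars : H.vars ⊆ A.vars ∩ B.vars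

/-! ## Interpolant lifting bases -/

/-- The structures `I` and `J` on `M` agree, except possibly on the function symbols in `S`. -/
def AgreeOff {M : Type w} (S : Set (FunSym L)) (I J : L.Structure M) : Prop :=
  (∀ (k : ℕ) (f : L.Functions k), (⟨k, f⟩ : FunSym L) ∉ S →
    ∀ xs : Fin k → M, I.funMap f xs = J.funMap f xs) ∧
  ∀ (k : ℕ) (R : L.Relations k) (xs : Fin k → M), I.RelMap R xs ↔ J.RelMap R xs

/-- The second-order formula `∃ S ∀ u A(u)`, with `S` a set of function symbols, is true
in `I`. -/
def SatExAll {M : Type w} (I : L.Structure M) (S : Set (FunSym L)) {m : ℕ} (A : Fml L m) : Prop :=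
  ∃ J : L.Structure M, AgreeOff S I J ∧ ∀ x : Fin m → M, A.Sat J x

/-- The second-order formula `∀ S ∃ v A(v)`, with `S` a set of function symbols, is true
in `I`. -/
def SatAllEx {M : Type w} (I : L.Structure M) (S : Set (FunSym L)) {m : ℕ} (A : Fml L m) : Prop :=
  ∀ J : L.Structure M, AgreeOff S I J → ∃ x : Fin m → M, A.Sat J x

/-- `⟨F, G, S, T, H⟩` is an interpolant lifting base. The variables `u` of `Fexp` and `v` of
`Gexp` are indexed by the separate types `Fin m` and `Fin k`, and the ground substitution is given
by its parts `θ` on `u` and `η` on `v`. -/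
structure IsLiftingBase (F G : Fml L 0) (S T : Set (FunSym L)) (H : Fml L 0) : Prop where
  finite_left : S.Finite
  finite_right : T.Finite
  disjoint : Disjoint S T
  ground : H.IsQF
  expansion : ∃ (m k : ℕ) (Fexp : Fml L m) (Gexp : Fml L k)
      (θ : Fin m → L.Term (Fin 0)) (η : Fin k → L.Term (Fin 0)),
    Fexp.IsQF ∧ Gexp.IsQF ∧
    (∀ (M : Type w) [Nonempty M] (I : L.Structure M),
      F.Sat I Fin.elim0 → SatExAll I S Fexp) ∧
    (∀ (M : Type w) [Nonempty M] (I : L.Structure M),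
      SatAllEx I T Gexp → G.Sat I Fin.elim0) ∧
    Fexp.preds ⊆ F.preds ∧
    Gexp.preds ⊆ G.preds ∧
    Fexp.funs ⊆ (F.funs ∩ G.funs) ∪ S ∧
    Gexp.funs ⊆ (F.funs ∩ G.funs) ∪ T ∧
    F.funs ∩ T = ∅ ∧
    G.funs ∩ S = ∅ ∧
    -- `C` holds the optional constant from `S ∪ T`.
    (∃ C : Set (L.Functions 0), C.Subsingleton ∧
      (∀ c ∈ C, (⟨0, c⟩ : FunSym L) ∈ S ∪ T) ∧
      (⋃ i, termFuns (θ i)) ∪ (⋃ i, termFuns (η i)) ⊆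
        Fexp.funs ∪ Gexp.funs ∪ (fun c => (⟨0, c⟩ : FunSym L)) '' C) ∧
    IsCraigLyndon.{u, v, w} (Fexp.subst θ) (Gexp.subst η) H

/-! ## Literals and clauses -/

/-- A literal: an atom (`pos = true`) or a negated atom (`pos = false`). -/
structure Lit (L : FirstOrder.Language.{u, v}) (α : Type) where
  pos : Bool
  arity : ℕ
  rel : L.Relations arity
  args : Fin arity → L.Term α

namespace Lit

variable {α β : Type}

/-- The complement of a literal. -/
def compl (A : Lit L α) : Lit L α := { A with pos := !A.pos }

/-- Application of a substitution to a literal. -/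
def subst (σ : α → L.Term β) (A : Lit L α) : Lit L β :=
  ⟨A.pos, A.arity, A.rel, fun i => (A.args i).subst σ⟩

/-- The variables of a literal. -/
def vars [DecidableEq α] (A : Lit L α) : Set α := ⋃ i, ((A.args i).varFinset : Set α)

end Lit

/-- A clause is a multiset of literals; a clause over `Fin 0` is a ground clause. -/
abbrev Clause (L : FirstOrder.Language.{u, v}) (α : Type) : Type (max u v) := Multiset (Lit L α)

namespace Clause

variable {α β : Type}

/-- Application of a substitution to a clause. -/
def subst (σ : α → L.Term β) (C : Clause L α) : Clause L β := C.map (Lit.subst σ)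

/-- The variables of a clause. -/
def vars [DecidableEq α] (C : Clause L α) : Set α := ⋃ A ∈ C, Lit.vars A

/-- `D` is an instance of `C`. -/
def IsInstance (C : Clause L α) (D : Clause L β) : Prop := ∃ σ : α → L.Term β, D = subst σ C

/-- `C` and `D` are variants of each other. -/
def IsVariant (C D : Clause L α) : Prop := IsInstance C D ∧ IsInstance D C

end Clause

/-- The formula is a disjunction of literals, which are those of the given clause; `⊥` is the
empty disjunction. -/
inductive ReadsAsClause : {n : ℕ} → Fml L n → Clause L (Fin n) → Prop
  | bot {n : ℕ} : ReadsAsClause (Fml.bot : Fml L n) 0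
  | pos {n k : ℕ} (R : L.Relations k) (ts : Fin k → L.Term (Fin n)) :
      ReadsAsClause (.atom R ts) {⟨true, k, R, ts⟩}
  | neg {n k : ℕ} (R : L.Relations k) (ts : Fin k → L.Term (Fin n)) :
      ReadsAsClause (.neg (.atom R ts)) {⟨false, k, R, ts⟩}
  | or {n : ℕ} {A B : Fml L n} {C D : Clause L (Fin n)} :
      ReadsAsClause A C → ReadsAsClause B D → ReadsAsClause (.or A B) (C + D)

/-- The formula is a CNF formula, represented by the given set of clauses; `⊤` is the empty
conjunction. -/
inductive ReadsAsCNF : {n : ℕ} → Fml L n → Set (Clause L (Fin n)) → Prop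
  | top {n : ℕ} : ReadsAsCNF (Fml.top : Fml L n) ∅
  | clause {n : ℕ} {A : Fml L n} {C : Clause L (Fin n)} :
      ReadsAsClause A C → ReadsAsCNF A {C}
  | and {n : ℕ} {A B : Fml L n} {X Y : Set (Clause L (Fin n))} :
      ReadsAsCNF A X → ReadsAsCNF B Y → ReadsAsCNF (.and A B) (X ∪ Y)

/-! ## Prenexing, Skolemization and CNF transformation -/

/-- The equivalences, used as rewrite rules from left to right, for the elimination of implication
and biconditional, conversion to negation normal form, distribution and truth value
simplification; they are understood modulo commutativity. -/
inductive PropRule : {n : ℕ} → Fml L n → Fml L n → Prop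
  | imp {n : ℕ} (A B : Fml L n) : PropRule (.imp A B) (.or (.neg A) B)
  | iff_cnf {n : ℕ} (A B : Fml L n) :
      PropRule (.iff A B) (.and (.or (.neg A) B) (.or A (.neg B)))
  | iff_dnf {n : ℕ} (A B : Fml L n) :
      PropRule (.iff A B) (.or (.and A B) (.and (.neg A) (.neg B)))
  | neg_neg {n : ℕ} (A : Fml L n) : PropRule (.neg (.neg A)) A
  | neg_and {n : ℕ} (A B : Fml L n) : PropRule (.neg (.and A B)) (.or (.neg A) (.neg B))
  | neg_or {n : ℕ} (A B : Fml L n) : PropRule (.neg (.or A B)) (.and (.neg A) (.neg B))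
  | dist {n : ℕ} (A B C : Fml L n) :
      PropRule (.or A (.and B C)) (.and (.or A B) (.or A C))
  | and_comm {n : ℕ} (A B : Fml L n) : PropRule (.and A B) (.and B A)
  | or_comm {n : ℕ} (A B : Fml L n) : PropRule (.or A B) (.or B A)
  | and_top {n : ℕ} (A : Fml L n) : PropRule (.and A .top) A
  | and_bot {n : ℕ} (A : Fml L n) : PropRule (.and A .bot) .bot
  | or_top {n : ℕ} (A : Fml L n) : PropRule (.or A .top) .top
  | or_bot {n : ℕ} (A : Fml L n) : PropRule (.or A .bot) A
  | neg_top {n : ℕ} : PropRule (.neg (.top : Fml L n)) .bot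
  | neg_bot {n : ℕ} : PropRule (.neg (.bot : Fml L n)) .top

/-- The rules for prenexing: those of `PropRule`, and the moving of quantifiers outwards over
negation, conjunction and disjunction. -/
inductive PrenexRule : {n : ℕ} → Fml L n → Fml L n → Prop
  | prop {n : ℕ} {A B : Fml L n} : PropRule A B → PrenexRule A B
  | neg_all {n : ℕ} (A : Fml L (n + 1)) : PrenexRule (.neg (.all A)) (.ex (.neg A))
  | neg_ex {n : ℕ} (A : Fml L (n + 1)) : PrenexRule (.neg (.ex A)) (.all (.neg A))
  | all_and_all {n : ℕ} (A B : Fml L (n + 1)) :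
      PrenexRule (.and (.all A) (.all B)) (.all (.and A B))
  | ex_or_ex {n : ℕ} (A B : Fml L (n + 1)) :
      PrenexRule (.or (.ex A) (.ex B)) (.ex (.or A B))
  | all_or {n : ℕ} (A : Fml L (n + 1)) (B : Fml L n) :
      PrenexRule (.or (.all A) B) (.all (.or A B.weaken))
  | ex_or {n : ℕ} (A : Fml L (n + 1)) (B : Fml L n) :
      PrenexRule (.or (.ex A) B) (.ex (.or A B.weaken))
  | all_and {n : ℕ} (A : Fml L (n + 1)) (B : Fml L n) :
      PrenexRule (.and (.all A) B) (.all (.and A B.weaken))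
  | ex_and {n : ℕ} (A : Fml L (n + 1)) (B : Fml L n) :
      PrenexRule (.and (.ex A) B) (.ex (.and A B.weaken))

/-- One rewrite step with a set of rules, at an arbitrary position in the formula. -/
inductive RewriteStep (R : {n : ℕ} → Fml L n → Fml L n → Prop) :
    {n : ℕ} → Fml L n → Fml L n → Prop
  | rule {n : ℕ} {A B : Fml L n} : R A B → RewriteStep R A B
  | neg {n : ℕ} {A A' : Fml L n} : RewriteStep R A A' → RewriteStep R (.neg A) (.neg A')
  | and_left {n : ℕ} {A A' : Fml L n} (B : Fml L n) :
      RewriteStep R A A' → RewriteStep R (.and A B) (.and A' B)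
  | and_right {n : ℕ} (A : Fml L n) {B B' : Fml L n} :
      RewriteStep R B B' → RewriteStep R (.and A B) (.and A B')
  | or_left {n : ℕ} {A A' : Fml L n} (B : Fml L n) :
      RewriteStep R A A' → RewriteStep R (.or A B) (.or A' B)
  | or_right {n : ℕ} (A : Fml L n) {B B' : Fml L n} :
      RewriteStep R B B' → RewriteStep R (.or A B) (.or A B')
  | imp_left {n : ℕ} {A A' : Fml L n} (B : Fml L n) :
      RewriteStep R A A' → RewriteStep R (.imp A B) (.imp A' B)
  | imp_right {n : ℕ} (A : Fml L n) {B B' : Fml L n} :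
      RewriteStep R B B' → RewriteStep R (.imp A B) (.imp A B')
  | iff_left {n : ℕ} {A A' : Fml L n} (B : Fml L n) :
      RewriteStep R A A' → RewriteStep R (.iff A B) (.iff A' B)
  | iff_right {n : ℕ} (A : Fml L n) {B B' : Fml L n} :
      RewriteStep R B B' → RewriteStep R (.iff A B) (.iff A B')
  | all {n : ℕ} {A A' : Fml L (n + 1)} : RewriteStep R A A' → RewriteStep R (.all A) (.all A')
  | ex {n : ℕ} {A A' : Fml L (n + 1)} : RewriteStep R A A' → RewriteStep R (.ex A) (.ex A')

/-- Finitely many rewrite steps. -/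
def Rewrites (R : {n : ℕ} → Fml L n → Fml L n → Prop) {n : ℕ} (A B : Fml L n) : Prop :=
  Relation.ReflTransGen (fun X Y : Fml L n => RewriteStep R X Y) A B

/-- The substitution that replaces the variable `x_n` by `f(x_0, …, x_{n-1})`. -/
def skolemSubst {n : ℕ} (f : L.Functions n) : Fin (n + 1) → L.Term (Fin n) :=
  Fin.snoc (α := fun _ => L.Term (Fin n)) (fun i => .var i) (.func f fun i => .var i)

/-- `Skolemizes A fs M`: the formula `A` is prenex, and the Skolemization of `∀ x_0 … ∀ x_{n-1} A`
with the Skolem functions `fs`, for the existential quantifiers from the left to the right, has the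
quantifier-free matrix `M`. -/
inductive Skolemizes : {n : ℕ} → Fml L n → List (FunSym L) → {m : ℕ} → Fml L m → Prop
  | matrix {n : ℕ} {A : Fml L n} : A.IsQF → Skolemizes A [] A
  | all {n m : ℕ} {A : Fml L (n + 1)} {fs : List (FunSym L)} {M : Fml L m} :
      Skolemizes A fs M → Skolemizes (.all A) fs M
  | ex {n m : ℕ} {A : Fml L (n + 1)} {fs : List (FunSym L)} {M : Fml L m} (f : L.Functions n) :
      Skolemizes (A.subst (skolemSubst f)) fs M → Skolemizes (.ex A) (⟨n, f⟩ :: fs) M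

/-- The set `X` of clauses, with variables `x_0, x_1, …`, is obtained from the sentence `A` by
prenexing, Skolemization with the Skolem functions `fs`, and CNF transformation. -/
def IsClausalForm (A : Fml L 0) (fs : List (FunSym L)) (X : Set (Clause L ℕ)) : Prop :=
  ∃ (P : Fml L 0) (m : ℕ) (M N : Fml L m) (Y : Set (Clause L (Fin m))),
    Rewrites PrenexRule A P ∧ Skolemizes P fs M ∧ Rewrites PropRule M N ∧ ReadsAsCNF N Y ∧
    X = Clause.subst (fun i : Fin m => .var (i : ℕ)) '' Y

/-! ## The resolution calculus, deductions and deduction trees -/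

/-- `σ` is a most general unifier of the literals `A` and `B`. -/
def IsMGU (σ : ℕ → L.Term ℕ) (A B : Lit L ℕ) : Prop :=
  A.subst σ = B.subst σ ∧
  ∀ τ : ℕ → L.Term ℕ, A.subst τ = B.subst τ → ∃ δ : ℕ → L.Term ℕ, ∀ x, τ x = (σ x).subst δ

/-- The first-order resolution calculus: binary resolution, with the premises renamed apart, and
factoring. -/
inductive ResRule : List (Clause L ℕ) → Clause L ℕ → Prop
  | resolution {P Q C D : Clause L ℕ} {A B : Lit L ℕ} {σ : ℕ → L.Term ℕ} :
      Clause.IsVariant P (A ::ₘ C) → Clause.IsVariant Q (B ::ₘ D) →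
      Disjoint (Clause.vars (A ::ₘ C)) (Clause.vars (B ::ₘ D)) →
      IsMGU σ A B.compl → ResRule [P, Q] (Clause.subst σ (C + D))
  | factoring {C : Clause L ℕ} {A B : Lit L ℕ} {σ : ℕ → L.Term ℕ} :
      IsMGU σ A B → ResRule [A ::ₘ B ::ₘ C] (Clause.subst σ (A ::ₘ C))

/-- The ground resolution calculus: ground resolution and merging. -/
inductive GrdRule : List (Clause L (Fin 0)) → Clause L (Fin 0) → Prop
  | resolution (C D : Clause L (Fin 0)) (A : Lit L (Fin 0)) :
      GrdRule [A ::ₘ C, A.compl ::ₘ D] (C + D)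
  | merging (C : Clause L (Fin 0)) (A : Lit L (Fin 0)) :
      GrdRule [A ::ₘ A ::ₘ C] (A ::ₘ C)

/-- The sequence `Cs` is a deduction from `X` in the calculus `R`: each member is in `X` or the
conclusion of an inference from preceding members. -/
def IsDeduction {α : Type} (R : List (Clause L α) → Clause L α → Prop) (X : Set (Clause L α))
    (Cs : List (Clause L α)) : Prop :=
  ∀ (i : ℕ) (E : Clause L α), Cs[i]? = some E →
    E ∈ X ∨ ∃ Ps : List (Clause L α), R Ps E ∧ ∀ P ∈ Ps, ∃ j < i, Cs[j]? = some P

/-- A refutation, or proof, is a deduction of the empty clause. -/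
def IsRefutation {α : Type} (R : List (Clause L α) → Clause L α → Prop) (X : Set (Clause L α))
    (Cs : List (Clause L α)) : Prop :=
  IsDeduction R X Cs ∧ Cs.getLast? = some 0

/-- Trees with labels in `β` whose nodes have at most two children. -/
inductive DTree (β : Type w) : Type w
  | leaf (b : β) : DTree β
  | unary (b : β) (T : DTree β) : DTree β
  | binary (b : β) (T U : DTree β) : DTree β

namespace DTree

variable {β : Type v} {γ : Type w}

/-- The label of the root. -/
def root : DTree β → β
  | leaf b => b
  | unary b _ => b
  | binary b _ _ => b

/-- The subtrees of which the root is a child of the root of the given tree. -/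
def children : DTree β → List (DTree β)
  | leaf _ => []
  | unary _ T => [T]
  | binary _ T U => [T, U]

/-- All subtrees, one for each node. -/
def subtrees : DTree β → Set (DTree β)
  | leaf b => {leaf b}
  | unary b T => {unary b T} ∪ T.subtrees
  | binary b T U => {binary b T U} ∪ T.subtrees ∪ U.subtrees

/-- The labels of the leaves. -/
def leaves : DTree β → Set β
  | leaf b => {b}
  | unary _ T => T.leaves
  | binary _ T U => T.leaves ∪ U.leaves

/-- The labels of all nodes. -/
def labels : DTree β → Set β
  | leaf b => {b}
  | unary b T => {b} ∪ T.labels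
  | binary b T U => {b} ∪ T.labels ∪ U.labels

/-- Application of a function to all labels. -/
def map (f : β → γ) : DTree β → DTree γ
  | leaf b => leaf (f b)
  | unary b T => unary (f b) (T.map f)
  | binary b T U => binary (f b) (T.map f) (U.map f)

end DTree

/-- The variables of a tree of clauses. -/
def treeVars (T : DTree (Clause L ℕ)) : Set ℕ := ⋃ C ∈ T.labels, Clause.vars C

/-- `IsExpansion X Cs i T`: the deduction tree `T` is obtained by expanding the deduction `Cs` from
`X` at its member with index `i`. The leaves are fresh copies of input clauses; for an inference,
the trees for the premises, which share no variables, are joined, and the most general unifier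
is applied to all clauses of the joined tree. The root clause is a variant of the member of the
deduction. -/
inductive IsExpansion (X : Set (Clause L ℕ)) (Cs : List (Clause L ℕ)) :
    ℕ → DTree (Clause L ℕ) → Prop
  | input {i : ℕ} {E E' : Clause L ℕ} :
      Cs[i]? = some E → E ∈ X → Clause.IsVariant E E' → IsExpansion X Cs i (.leaf E')
  | resolution {i j k : ℕ} {E C D : Clause L ℕ} {A B : Lit L ℕ} {σ : ℕ → L.Term ℕ}
      {T U : DTree (Clause L ℕ)} :
      Cs[i]? = some E → j < i → k < i → IsExpansion X Cs j T → IsExpansion X Cs k U →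
      Disjoint (treeVars T) (treeVars U) → T.root = A ::ₘ C → U.root = B ::ₘ D →
      IsMGU σ A B.compl → Clause.IsVariant E (Clause.subst σ (C + D)) →
      IsExpansion X Cs i (.binary (Clause.subst σ (C + D))
        (T.map (Clause.subst σ)) (U.map (Clause.subst σ)))
  | factoring {i j : ℕ} {E C : Clause L ℕ} {A B : Lit L ℕ} {σ : ℕ → L.Term ℕ}
      {T : DTree (Clause L ℕ)} :
      Cs[i]? = some E → j < i → IsExpansion X Cs j T → T.root = A ::ₘ B ::ₘ C →
      IsMGU σ A B → Clause.IsVariant E (Clause.subst σ (A ::ₘ C)) →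
      IsExpansion X Cs i (.unary (Clause.subst σ (A ::ₘ C)) (T.map (Clause.subst σ)))

/-- The sequence `Ds` results from converting the ground deduction tree `T` into a deduction: each
member is the label of a node of `T` such that the labels of its children precede it, and the last
member is the label of the root. Nodes with identical labels may be represented by a single
member. -/
def IsLinearization (T : DTree (Clause L (Fin 0))) (Ds : List (Clause L (Fin 0))) : Prop :=
  (∀ (i : ℕ) (E : Clause L (Fin 0)), Ds[i]? = some E →
    ∃ s ∈ T.subtrees, s.root = E ∧ ∀ c ∈ s.children, ∃ j < i, Ds[j]? = some c.root) ∧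
  Ds.getLast? = some T.root

/-- The ground deduction `Ds` from the set `Z` of ground clauses is for the deduction `Cs` from
`X`, where the variables of the deduction tree are instantiated by ground terms that are built from
the function symbols in `S`. -/
def IsGroundDeductionFor (X : Set (Clause L ℕ)) (Cs : List (Clause L ℕ)) (S : Set (FunSym L))
    (Z : Set (Clause L (Fin 0))) (Ds : List (Clause L (Fin 0))) : Prop :=
  IsDeduction GrdRule Z Ds ∧
  ∃ (T : DTree (Clause L ℕ)) (τ : ℕ → L.Term (Fin 0)),
    IsExpansion X Cs (Cs.length - 1) T ∧
    (∀ x ∈ treeVars T, termFuns (τ x) ⊆ S) ∧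
    Z = (T.map (Clause.subst τ)).leaves ∧
    IsLinearization (T.map (Clause.subst τ)) Ds

/-- The input clauses of the ground deduction `Ds` from `Z` that are instances of clauses
in `X`. -/
def inputInstances (X : Set (Clause L ℕ)) (Z : Set (Clause L (Fin 0)))
    (Ds : List (Clause L (Fin 0))) : Set (Clause L (Fin 0)) :=
  {E | E ∈ Ds ∧ E ∈ Z ∧ ∃ C ∈ X, Clause.IsInstance C E}

/-- Some member of `S` is a constant. -/
def HasConst (S : Set (FunSym L)) : Prop := ∃ c : L.Functions 0, (⟨0, c⟩ : FunSym L) ∈ S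

/-- `S` (`T`) is the union of the Skolem functions `fs` (`gs`) for `F` (`G`) and the functions that
occur only in `F` (`G`); if neither in these nor in the functions shared by `F` and `G` there is a
constant, then in addition a fresh constant is in one of `S` and `T`. -/
def AreLiftingSymbols (F G : Fml L 0) (fs gs : List (FunSym L)) (S T : Set (FunSym L)) : Prop :=
  let S₀ : Set (FunSym L) := {f | f ∈ fs} ∪ (F.funs \ G.funs)
  let T₀ : Set (FunSym L) := {g | g ∈ gs} ∪ (G.funs \ F.funs)
  (HasConst (S₀ ∪ T₀ ∪ (F.funs ∩ G.funs)) ∧ S = S₀ ∧ T = T₀) ∨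
  (¬ HasConst (S₀ ∪ T₀ ∪ (F.funs ∩ G.funs)) ∧ ∃ c : L.Functions 0,
    (S = insert (⟨0, c⟩ : FunSym L) S₀ ∧ T = T₀) ∨ (S = S₀ ∧ T = insert (⟨0, c⟩ : FunSym L) T₀))

end CraigLifting

open CraigLifting

namespace CraigLifting

variable {L : FirstOrder.Language.{u, v}}

open FirstOrder.Language

/-! ## Terms -/

/-! Every clause of `Fgrd` is an instance of a clause of the Skolemized CNF of `F`. Replacing each
ground clause by the clause it instantiates, with separate variables for each conjunct, gives a
quantifier-free formula that has `Fgrd` as an instance under some θ. It follows from the matrix of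
the Skolemized form, so `F` entails its universal closure after second-order quantification over the
Skolem functions. The same construction for `¬ G` gives a formula whose negation serves as the
second expansion (`ReadsAsCNF.exists_lift`, `Skolemizes.exists_agreeOff`).

The difficulty is condition 5: symbols in the range of the substitution must occur in an expansion
or be one extra constant, while the given terms may use symbols that no lifted clause contains. Two
devices resolve this.

Padding: if `F` contains a predicate of positive arity, a valid formula over it that mentions all
symbols allowed on the `F` side is conjoined to the lifted formula; likewise for `¬ G`
(`exists_valid`).

Cutting: with `K` the set of permitted symbols, every maximal subterm of the substitution whose head
lies outside `K` is replaced by a constant of `K`. Semantically, this amounts to making all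
functions outside `K` constant (`realize_restrictTerm`), so entailments to and from a formula with
symbols in `K` survive.

If the interpolant contains a function symbol, it also contains a predicate of positive arity, which
by interpolation occurs in both `F` and `G`. Then both paddings are available, and cutting leaves
the two instances unchanged. If it contains no function symbol, the function condition is void and
the semantic argument suffices.

From the ground proof only one fact is needed: the input clauses contain no symbols beyond the
allowed ones. It holds because most general unifiers introduce no new symbols
(`IsMGU.termFuns_subset`). -/

theorem termFuns_subst_subset {α β : Type} (σ : α → L.Term β) (K : Set (FunSym L)) (t : L.Term α)
    (ht : termFuns t ⊆ K) (hσ : ∀ x, termFuns (σ x) ⊆ K) : termFuns (t.subst σ) ⊆ K := by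
  induction t with
  | var x => exact hσ x
  | func f ts ih =>
    simp only [termFuns, Term.subst, Set.union_subset_iff, Set.iUnion_subset_iff] at ht ⊢
    exact ⟨ht.1, fun i => ih i (ht.2 i)⟩

/-- This version bounds σ only on variables that occur in the term, because the grounding
substitution of a deduction tree is constrained only on the variables of the tree. -/
theorem termFuns_subst_subset_of_vars {α β : Type} [DecidableEq α] (σ : α → L.Term β)
    (K : Set (FunSym L)) (t : L.Term α) (ht : termFuns t ⊆ K)
    (hσ : ∀ x ∈ t.varFinset, termFuns (σ x) ⊆ K) : termFuns (t.subst σ) ⊆ K := by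
  induction t with
  | var x => exact hσ x (by simp [Term.varFinset])
  | func f ts ih =>
    simp only [termFuns, Term.subst, Set.union_subset_iff, Set.iUnion_subset_iff] at ht ⊢
    refine ⟨ht.1, fun i => ih i (ht.2 i) fun x hx => hσ x ?_⟩
    simp only [Term.varFinset, Finset.mem_biUnion, Finset.mem_univ, true_and]
    exact ⟨i, hx⟩

theorem termFuns_subset_subst {α β : Type} (σ : α → L.Term β) (t : L.Term α) :
    termFuns t ⊆ termFuns (t.subst σ) := by
  induction t with
  | var x => simp [termFuns]
  | func f ts ih =>
    simp only [termFuns, Term.subst]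
    exact Set.union_subset_union_right _ (Set.iUnion_mono ih)

theorem termFuns_relabel {α β : Type} (g : α → β) (t : L.Term α) :
    termFuns (t.relabel g) = termFuns t := by
  induction t with
  | var x => simp [termFuns, Term.relabel]
  | func f ts ih => simp [termFuns, Term.relabel, ih]

theorem termFuns_finite {α : Type} (t : L.Term α) : (termFuns t).Finite := by
  induction t with
  | var x => simp [termFuns]
  | func f ts ih => exact (Set.finite_singleton _).union (Set.finite_iUnion ih)

theorem subst_subst {α β γ : Type} (σ : α → L.Term β) (τ : β → L.Term γ) (t : L.Term α) :
    (t.subst σ).subst τ = t.subst fun x => (σ x).subst τ := by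
  induction t with
  | var x => rfl
  | func f ts ih => simp [Term.subst, ih]

/-! ### Cutting terms and structures down to a set of symbols -/

open Classical in
/-- Replacement of all maximal subterms whose head is not in `K` by the term `c`. -/
noncomputable def restrictTerm {α : Type} (K : Set (FunSym L)) (c : L.Term α) :
    L.Term α → L.Term α
  | .var x => .var x
  | .func (l := k) f ts =>
      if (⟨k, f⟩ : FunSym L) ∈ K then .func f fun i => restrictTerm K c (ts i) else c

theorem termFuns_restrictTerm_subset {α : Type} (K : Set (FunSym L)) (c : L.Term α)
    (hc : termFuns c ⊆ K) (t : L.Term α) : termFuns (restrictTerm K c t) ⊆ K := by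
  induction t with
  | var x => simp [restrictTerm, termFuns]
  | func f ts ih =>
    rw [restrictTerm]
    split_ifs with h
    · simp only [termFuns, Set.union_subset_iff, Set.singleton_subset_iff,
        Set.iUnion_subset_iff]
      exact ⟨h, ih⟩
    · exact hc

theorem restrictTerm_subst {α β : Type} (K : Set (FunSym L)) (c : L.Term β) (σ : α → L.Term β)
    (t : L.Term α) (ht : termFuns t ⊆ K) :
    restrictTerm K c (t.subst σ) = t.subst fun x => restrictTerm K c (σ x) := by
  induction t with
  | var x => rfl
  | func f ts ih =>
    simp only [termFuns, Set.union_subset_iff, Set.singleton_subset_iff,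
      Set.iUnion_subset_iff] at ht
    simp only [Term.subst, restrictTerm, if_pos ht.1, ih _ (ht.2 _)]

theorem restrictTerm_eq_self {α : Type} (K : Set (FunSym L)) (c : L.Term α) (t : L.Term α)
    (ht : termFuns t ⊆ K) : restrictTerm K c t = t := by
  induction t with
  | var x => rfl
  | func f ts ih =>
    simp only [termFuns, Set.union_subset_iff, Set.singleton_subset_iff,
      Set.iUnion_subset_iff] at ht
    simp only [restrictTerm, if_pos ht.1, ih _ (ht.2 _)]

/-- Cutting σ may still change its values at variables outside `t`, so the equation is one between
instances and not between substitutions. -/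
theorem subst_restrictTerm_eq {α β : Type} (K : Set (FunSym L)) (c : L.Term β) (σ : α → L.Term β)
    (t : L.Term α) (ht : termFuns (t.subst σ) ⊆ K) :
    (t.subst fun x => restrictTerm K c (σ x)) = t.subst σ := by
  rw [← restrictTerm_subst K c σ t ((termFuns_subset_subst σ t).trans ht),
    restrictTerm_eq_self K c _ ht]

open Classical in
/-- The structure `I` with all functions not in `K` redefined as constant with value `a`. -/
@[reducible] noncomputable def restrictStructure {M : Type w} (K : Set (FunSym L)) (a : M)
    (I : L.Structure M) : L.Structure M where
  funMap {k} f xs := if (⟨k, f⟩ : FunSym L) ∈ K then I.funMap f xs else a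
  RelMap R xs := I.RelMap R xs

theorem restrictStructure_funMap_of_mem {M : Type w} {K : Set (FunSym L)} (a : M)
    (I : L.Structure M) {k : ℕ} {f : L.Functions k} (hf : (⟨k, f⟩ : FunSym L) ∈ K)
    (xs : Fin k → M) : (restrictStructure K a I).funMap f xs = I.funMap f xs := if_pos hf

theorem restrictStructure_funMap_of_notMem {M : Type w} {K : Set (FunSym L)} (a : M)
    (I : L.Structure M) {k : ℕ} {f : L.Functions k} (hf : (⟨k, f⟩ : FunSym L) ∉ K)
    (xs : Fin k → M) : (restrictStructure K a I).funMap f xs = a := if_neg hf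

theorem agreeOff_restrictStructure {M : Type w} (K : Set (FunSym L)) (a : M)
    (I : L.Structure M) : AgreeOff Kᶜ I (restrictStructure K a I) := by
  refine ⟨fun k f hf xs => ?_, fun k R xs => Iff.rfl⟩
  rw [Set.notMem_compl_iff] at hf
  exact (restrictStructure_funMap_of_mem a I hf xs).symm

/-- Induction on the term: a cut subterm takes the value of `c`, which is exactly the constant value
that the restricted structure gives to the head of that subterm. -/
theorem realize_restrictTerm {M : Type w} {α : Type} (K : Set (FunSym L)) (c : L.Term α)
    (I : L.Structure M) (x : α → M) (t : L.Term α) :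
    (restrictTerm K c t).realize x
      = @Term.realize L M (restrictStructure K (c.realize x) I) α x t := by
  induction t with
  | var x => rfl
  | func f ts ih =>
    rw [restrictTerm]
    split_ifs with h
    · simp only [Term.realize, restrictStructure_funMap_of_mem _ I h, ih]
    · simp only [Term.realize, restrictStructure_funMap_of_notMem _ I h]

theorem realize_congr {M : Type w} {α : Type} {S : Set (FunSym L)} {I J : L.Structure M}
    (h : AgreeOff S I J) (t : L.Term α) (ht : Disjoint (termFuns t) S) (x : α → M) :
    @Term.realize L M I α x t = @Term.realize L M J α x t := by
  induction t with
  | var x => rfl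
  | func f ts ih =>
    simp only [termFuns, Set.disjoint_union_left, Set.disjoint_singleton_left,
      Set.disjoint_iUnion_left] at ht
    simp only [Term.realize]
    rw [h.1 _ _ ht.1]
    congr 1
    funext i
    exact ih i (ht.2 i)

theorem AgreeOff.refl {M : Type w} (S : Set (FunSym L)) (I : L.Structure M) : AgreeOff S I I :=
  ⟨fun _ _ _ _ => rfl, fun _ _ _ => Iff.rfl⟩

theorem AgreeOff.mono {M : Type w} {S T : Set (FunSym L)} {I J : L.Structure M} (hST : S ⊆ T)
    (h : AgreeOff S I J) : AgreeOff T I J :=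
  ⟨fun k f hf => h.1 k f fun hS => hf (hST hS), h.2⟩

theorem AgreeOff.trans {M : Type w} {S : Set (FunSym L)} {I J J' : L.Structure M}
    (h : AgreeOff S I J) (h' : AgreeOff S J J') : AgreeOff S I J' :=
  ⟨fun k f hf xs => (h.1 k f hf xs).trans (h'.1 k f hf xs),
    fun k R xs => (h.2 k R xs).trans (h'.2 k R xs)⟩

/-! ## Formulas -/

namespace Fml

theorem sat_congr {M : Type w} {S : Set (FunSym L)} {I J : L.Structure M} (h : AgreeOff S I J)
    {n : ℕ} (A : Fml L n) (hA : Disjoint A.funs S) (x : Fin n → M) :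
    A.Sat I x ↔ A.Sat J x := by
  induction A with
  | top => rfl
  | bot => rfl
  | atom R ts =>
    simp only [funs, Set.disjoint_iUnion_left] at hA
    simp only [Sat, h.2, fun i => realize_congr h (ts i) (hA i) x]
  | neg A ih => simp only [Sat, ih hA]
  | and A B ihA ihB | or A B ihA ihB | imp A B ihA ihB | iff A B ihA ihB =>
    simp only [funs, Set.disjoint_union_left] at hA
    simp only [Sat, ihA hA.1, ihB hA.2]
  | all A ih | ex A ih => simp only [Sat, ih hA]

theorem sat_subst {M : Type w} (I : L.Structure M) {n m : ℕ} (A : Fml L n)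
    (σ : Fin n → L.Term (Fin m)) (x : Fin m → M) :
    (A.subst σ).Sat I x ↔ A.Sat I fun i => (σ i).realize x := by
  have lift : ∀ {n m : ℕ} (σ : Fin n → L.Term (Fin m)) (x : Fin m → M) (a : M),
      (fun i => (liftSubst σ i).realize (Fin.snoc (α := fun _ => M) x a))
        = Fin.snoc (α := fun _ => M) (fun i => (σ i).realize x) a := by
    intro n m σ x a
    funext i
    refine Fin.lastCases ?_ (fun i => ?_) i
    · simp [liftSubst]
    · simp only [liftSubst, Fin.snoc_castSucc, Term.realize_relabel]
      congr 1
      funext j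
      simp
  induction A generalizing m with
  | top => rfl
  | bot => rfl
  | atom R ts => simp only [Sat, subst, Term.realize_subst]
  | neg A ih => simp only [Sat, subst, ih]
  | and A B ihA ihB | or A B ihA ihB | imp A B ihA ihB | iff A B ihA ihB =>
    simp only [Sat, subst, ihA, ihB]
  | all A ih | ex A ih => simp only [Sat, subst, ih, lift]

theorem sat_weaken {M : Type w} (I : L.Structure M) {n : ℕ} (A : Fml L n) (x : Fin n → M)
    (a : M) : A.weaken.Sat I (Fin.snoc (α := fun _ => M) x a) ↔ A.Sat I x := by
  rw [weaken, sat_subst]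
  simp

theorem predsAux_subst {n m : ℕ} (A : Fml L n) (σ : Fin n → L.Term (Fin m)) (b : Bool) :
    (A.subst σ).predsAux b = A.predsAux b := by
  induction A generalizing m b with
  | top => rfl
  | bot => rfl
  | atom R ts => rfl
  | neg A ih => simp only [predsAux, subst, ih]
  | and A B ihA ihB | or A B ihA ihB | imp A B ihA ihB | iff A B ihA ihB =>
    simp only [predsAux, subst, ihA, ihB]
  | all A ih | ex A ih => simp only [predsAux, subst, ih]

theorem preds_subst {n m : ℕ} (A : Fml L n) (σ : Fin n → L.Term (Fin m)) :
    (A.subst σ).preds = A.preds := predsAux_subst A σ true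

theorem mem_predsAux_not {n : ℕ} (A : Fml L n) (b c : Bool) (p : PredSym L) :
    (c, p) ∈ A.predsAux (!b) ↔ (!c, p) ∈ A.predsAux b := by
  induction A generalizing b with
  | top => simp [predsAux]
  | bot => simp [predsAux]
  | atom R ts => cases b <;> cases c <;> simp [predsAux]
  | neg A ih => simp only [predsAux, ih]
  | and A B ihA ihB | or A B ihA ihB | imp A B ihA ihB | iff A B ihA ihB =>
    simp only [predsAux, Set.mem_union, ihA, ihB]
  | all A ih | ex A ih => simp only [predsAux, ih]

theorem mem_preds_neg {n : ℕ} (A : Fml L n) (c : Bool) (p : PredSym L) :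
    (c, p) ∈ (neg A).preds ↔ (!c, p) ∈ A.preds :=
  mem_predsAux_not A true c p

theorem funs_subst_subset {n m : ℕ} (A : Fml L n) (σ : Fin n → L.Term (Fin m))
    (K : Set (FunSym L)) (hA : A.funs ⊆ K) (hσ : ∀ i, termFuns (σ i) ⊆ K) :
    (A.subst σ).funs ⊆ K := by
  have lift : ∀ {n m : ℕ} (σ : Fin n → L.Term (Fin m)), (∀ i, termFuns (σ i) ⊆ K) →
      ∀ i, termFuns (liftSubst σ i) ⊆ K := by
    intro n m σ hσ i
    refine Fin.lastCases ?_ (fun i => ?_) i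
    · simp [liftSubst, termFuns]
    · simpa [liftSubst, termFuns_relabel] using hσ i
  induction A generalizing m with
  | top => exact hA
  | bot => exact hA
  | atom R ts =>
    simp only [funs, subst, Set.iUnion_subset_iff] at hA ⊢
    exact fun i => termFuns_subst_subset σ K _ (hA i) hσ
  | neg A ih => exact ih σ hA hσ
  | and A B ihA ihB | or A B ihA ihB | imp A B ihA ihB | iff A B ihA ihB =>
    simp only [funs, subst, Set.union_subset_iff] at hA ⊢
    exact ⟨ihA σ hA.1 hσ, ihB σ hA.2 hσ⟩
  | all A ih | ex A ih => exact ih _ hA (lift σ hσ)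

theorem funs_subset_subst {n m : ℕ} (A : Fml L n) (σ : Fin n → L.Term (Fin m)) :
    A.funs ⊆ (A.subst σ).funs := by
  induction A generalizing m with
  | top => exact subset_rfl
  | bot => exact subset_rfl
  | atom R ts => exact Set.iUnion_mono fun i => termFuns_subset_subst σ (ts i)
  | neg A ih => exact ih σ
  | and A B ihA ihB | or A B ihA ihB | imp A B ihA ihB | iff A B ihA ihB =>
    exact Set.union_subset_union (ihA σ) (ihB σ)
  | all A ih | ex A ih => exact ih _

theorem funs_subst_var {n m : ℕ} (A : Fml L n) (g : Fin n → Fin m) :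
    (A.subst fun i => .var (g i)).funs = A.funs :=
  (funs_subst_subset A _ _ subset_rfl fun i => by simp [termFuns]).antisymm (funs_subset_subst A _)

theorem funs_weaken {n : ℕ} (A : Fml L n) : A.weaken.funs = A.funs :=
  funs_subst_var A Fin.castSucc

theorem predsAux_weaken {n : ℕ} (A : Fml L n) (b : Bool) :
    A.weaken.predsAux b = A.predsAux b := predsAux_subst A _ b

theorem funs_finite {n : ℕ} (A : Fml L n) : A.funs.Finite := by
  induction A with
  | top => exact Set.finite_empty
  | bot => exact Set.finite_empty
  | atom R ts => exact Set.finite_iUnion fun i => termFuns_finite (ts i)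
  | neg A ih => exact ih
  | and A B ihA ihB | or A B ihA ihB | imp A B ihA ihB | iff A B ihA ihB => exact ihA.union ihB
  | all A ih | ex A ih => exact ih

/-- In logic without equality a function symbol can only occur inside an argument of a predicate,
which therefore has positive arity. This makes padding possible whenever function symbols matter. -/
theorem exists_pred_of_mem_funs {n : ℕ} (A : Fml L n) {f : FunSym L} (hf : f ∈ A.funs)
    (b : Bool) : ∃ (c : Bool) (k : ℕ) (R : L.Relations (k + 1)),
      (c, (⟨k + 1, R⟩ : PredSym L)) ∈ A.predsAux b := by
  induction A generalizing b with
  | top => exact hf.elim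
  | bot => exact hf.elim
  | @atom n k R ts =>
    obtain ⟨i, hi⟩ := Set.mem_iUnion.1 hf
    cases k with
    | zero => exact i.elim0
    | succ k => exact ⟨b, k, R, rfl⟩
  | neg A ih => exact ih hf _
  | and A B ihA ihB | or A B ihA ihB =>
    rcases hf with hf | hf
    · obtain ⟨c, k, R, h⟩ := ihA hf b
      exact ⟨c, k, R, Or.inl h⟩
    · obtain ⟨c, k, R, h⟩ := ihB hf b
      exact ⟨c, k, R, Or.inr h⟩
  | imp A B ihA ihB =>
    rcases hf with hf | hf
    · obtain ⟨c, k, R, h⟩ := ihA hf (!b)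
      exact ⟨c, k, R, Or.inl h⟩
    · obtain ⟨c, k, R, h⟩ := ihB hf b
      exact ⟨c, k, R, Or.inr h⟩
  | iff A B ihA ihB =>
    rcases hf with hf | hf
    · obtain ⟨c, k, R, h⟩ := ihA hf b
      exact ⟨c, k, R, Or.inl (Or.inl h)⟩
    · obtain ⟨c, k, R, h⟩ := ihB hf b
      exact ⟨c, k, R, Or.inr (Or.inl h)⟩
  | all A ih | ex A ih => exact ih hf b

theorem IsQF.subst {n m : ℕ} {A : Fml L n} (hA : A.IsQF) (σ : Fin n → L.Term (Fin m)) :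
    (A.subst σ).IsQF := by
  induction A with
  | top => trivial
  | bot => trivial
  | atom R ts => trivial
  | neg A ih => exact ih hA σ
  | and A B ihA ihB | or A B ihA ihB | imp A B ihA ihB | iff A B ihA ihB =>
    exact ⟨ihA hA.1 σ, ihB hA.2 σ⟩
  | all A ih | ex A ih => exact hA.elim

theorem IsQF.subst_subst {n m l : ℕ} {A : Fml L n} (hA : A.IsQF) (σ : Fin n → L.Term (Fin m))
    (τ : Fin m → L.Term (Fin l)) :
    (A.subst σ).subst τ = A.subst fun i => (σ i).subst τ := by
  induction A with
  | top => rfl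
  | bot => rfl
  | atom R ts => simp only [Fml.subst, CraigLifting.subst_subst]
  | neg A ih => simp only [Fml.subst, ih hA]
  | and A B ihA ihB | or A B ihA ihB | imp A B ihA ihB | iff A B ihA ihB =>
    simp only [Fml.subst, ihA hA.1, ihB hA.2]
  | all A ih | ex A ih => exact hA.elim

theorem IsQF.subst_restrictTerm_eq {n m : ℕ} {A : Fml L n} (hA : A.IsQF) (K : Set (FunSym L))
    (c : L.Term (Fin m)) (σ : Fin n → L.Term (Fin m)) (hK : (A.subst σ).funs ⊆ K) :
    (A.subst fun i => restrictTerm K c (σ i)) = A.subst σ := by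
  induction A with
  | top => rfl
  | bot => rfl
  | atom R ts =>
    simp only [Fml.subst, funs, Set.iUnion_subset_iff] at hK ⊢
    simp only [CraigLifting.subst_restrictTerm_eq K c σ _ (hK _)]
  | neg A ih => simp only [Fml.subst, ih hA σ hK]
  | and A B ihA ihB | or A B ihA ihB | imp A B ihA ihB | iff A B ihA ihB =>
    simp only [Fml.subst, funs, Set.union_subset_iff] at hK ⊢
    simp only [ihA hA.1 σ hK.1, ihB hA.2 σ hK.2]
  | all A ih | ex A ih => exact hA.elim

/-- Since the symbols of `A` lie in `K`, cutting affects only the substituted terms. It can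
therefore be traded for a change of structure. -/
theorem sat_subst_restrictTerm {M : Type w} (I : L.Structure M) {n m : ℕ} (A : Fml L n)
    (K : Set (FunSym L)) (hK : A.funs ⊆ K) (c : L.Term (Fin m)) (σ : Fin n → L.Term (Fin m))
    (x : Fin m → M) :
    (A.subst fun i => restrictTerm K c (σ i)).Sat I x ↔
      (A.subst σ).Sat (restrictStructure K (c.realize x) I) x := by
  rw [sat_subst, sat_subst]
  simp only [realize_restrictTerm]
  exact sat_congr (agreeOff_restrictStructure K _ I) A (Set.disjoint_compl_right_iff_subset.2 hK) _

end Fml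

/-! ## Prenexing, Skolemization and CNF transformation -/

/-- `B` is equivalent to `A` in all structures with nonempty carrier, and contains no further
symbols. -/
structure Refines {n : ℕ} (A B : Fml L n) : Prop where
  sat : ∀ (M : Type w) [Nonempty M] (I : L.Structure M) (x : Fin n → M), B.Sat I x ↔ A.Sat I x
  funs : B.funs ⊆ A.funs
  preds : ∀ b, B.predsAux b ⊆ A.predsAux b

theorem PropRule.refines {n : ℕ} {A B : Fml L n} (h : PropRule A B) :
    Refines.{u, v, w} A B := by
  refine ⟨fun M _ I x => ?_, ?_, fun b => ?_⟩
  · cases h <;> simp only [Fml.Sat] <;> tauto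
  · cases h <;> simp only [Fml.funs] <;> intro f <;>
      (try simp only [Set.mem_union]) <;> tauto
  · cases h <;> simp only [Fml.predsAux, Bool.not_not] <;> intro f <;>
      (try simp only [Set.mem_union]) <;> tauto

theorem PrenexRule.refines {n : ℕ} {A B : Fml L n} (h : PrenexRule A B) :
    Refines.{u, v, w} A B := by
  refine ⟨fun M _ I x => ?_, ?_, fun b => ?_⟩
  · cases h with
    | prop h => exact h.refines.sat M I x
    | neg_all A => simp [Fml.Sat]
    | neg_ex A => simp [Fml.Sat]
    | all_and_all A B => simp [Fml.Sat, forall_and]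
    | ex_or_ex A B => simp [Fml.Sat, exists_or]
    | all_or A B => simp [Fml.Sat, Fml.sat_weaken, forall_or_right]
    | ex_or A B => simp [Fml.Sat, Fml.sat_weaken, exists_or]
    | all_and A B => simp [Fml.Sat, Fml.sat_weaken, forall_and]
    | ex_and A B => simp [Fml.Sat, Fml.sat_weaken]
  · cases h with
    | prop h => exact (PropRule.refines.{u, v, w} h).funs
    | _ => simp [Fml.funs, Fml.funs_weaken]
  · cases h with
    | prop h => exact (PropRule.refines.{u, v, w} h).preds b
    | _ => simp [Fml.predsAux, Fml.predsAux_weaken]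

theorem RewriteStep.refines {R : {n : ℕ} → Fml L n → Fml L n → Prop}
    (hR : ∀ {n : ℕ} {A B : Fml L n}, R A B → Refines.{u, v, w} A B)
    {n : ℕ} {A B : Fml L n} (h : RewriteStep R A B) : Refines.{u, v, w} A B := by
  induction h with
  | rule h => exact hR h
  | neg _ ih =>
    exact ⟨fun M _ I x => by simp only [Fml.Sat, ih.sat M I], ih.funs, fun b => ih.preds _⟩
  | and_left B _ ih | or_left B _ ih =>
    exact ⟨fun M _ I x => by simp only [Fml.Sat, ih.sat M I],
      Set.union_subset_union_left _ ih.funs, fun b => Set.union_subset_union_left _ (ih.preds _)⟩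
  | and_right B _ ih | or_right B _ ih =>
    exact ⟨fun M _ I x => by simp only [Fml.Sat, ih.sat M I],
      Set.union_subset_union_right _ ih.funs,
      fun b => Set.union_subset_union_right _ (ih.preds _)⟩
  | imp_left B _ ih =>
    exact ⟨fun M _ I x => by simp only [Fml.Sat, ih.sat M I],
      Set.union_subset_union_left _ ih.funs, fun b => Set.union_subset_union_left _ (ih.preds _)⟩
  | imp_right B _ ih =>
    exact ⟨fun M _ I x => by simp only [Fml.Sat, ih.sat M I],
      Set.union_subset_union_right _ ih.funs,
      fun b => Set.union_subset_union_right _ (ih.preds _)⟩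
  | iff_left B _ ih =>
    exact ⟨fun M _ I x => by simp only [Fml.Sat, ih.sat M I],
      Set.union_subset_union_left _ ih.funs,
      fun b => Set.union_subset_union_left _ (Set.union_subset_union (ih.preds _) (ih.preds _))⟩
  | iff_right B _ ih =>
    exact ⟨fun M _ I x => by simp only [Fml.Sat, ih.sat M I],
      Set.union_subset_union_right _ ih.funs,
      fun b => Set.union_subset_union_right _ (Set.union_subset_union (ih.preds _) (ih.preds _))⟩
  | all _ ih | ex _ ih =>
    exact ⟨fun M _ I x => by simp only [Fml.Sat, ih.sat M I], ih.funs, fun b => ih.preds _⟩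

theorem Rewrites.refines {R : {n : ℕ} → Fml L n → Fml L n → Prop}
    (hR : ∀ {n : ℕ} {A B : Fml L n}, R A B → Refines.{u, v, w} A B)
    {n : ℕ} {A B : Fml L n} (h : Rewrites R A B) : Refines.{u, v, w} A B := by
  induction h with
  | refl => exact ⟨fun M _ I x => Iff.rfl, subset_rfl, fun b => subset_rfl⟩
  | tail _ h ih =>
    have h' := RewriteStep.refines hR h
    exact ⟨fun M _ I x => (h'.sat M I x).trans (ih.sat M I x), h'.funs.trans ih.funs,
      fun b => (h'.preds b).trans (ih.preds b)⟩

theorem termFuns_skolemSubst_subset {n : ℕ} (f : L.Functions n) (i : Fin (n + 1)) :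
    termFuns (skolemSubst f i) ⊆ {(⟨n, f⟩ : FunSym L)} := by
  refine Fin.lastCases ?_ (fun i => ?_) i
  · simp [skolemSubst, termFuns]
  · simp [skolemSubst, termFuns]

theorem Skolemizes.funs_subset {n m : ℕ} {A : Fml L n} {fs : List (FunSym L)} {N : Fml L m}
    (h : Skolemizes A fs N) : N.funs ⊆ A.funs ∪ {f | f ∈ fs} := by
  induction h with
  | matrix h => exact Set.subset_union_left
  | all _ ih => exact ih
  | @ex n m A fs M f _ ih =>
    refine ih.trans (Set.union_subset ?_ fun g hg => Or.inr (List.mem_cons_of_mem _ hg))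
    refine Fml.funs_subst_subset _ _ _ Set.subset_union_left fun i =>
      (termFuns_skolemSubst_subset f i).trans ?_
    rintro _ rfl
    exact Or.inr List.mem_cons_self

theorem Skolemizes.preds_eq {n m : ℕ} {A : Fml L n} {fs : List (FunSym L)} {N : Fml L m}
    (h : Skolemizes A fs N) : N.preds = A.preds := by
  induction h with
  | matrix h => rfl
  | all _ ih => exact ih
  | ex f _ ih => exact ih.trans (Fml.preds_subst _ _)

theorem Skolemizes.isQF {n m : ℕ} {A : Fml L n} {fs : List (FunSym L)} {N : Fml L m}
    (h : Skolemizes A fs N) : N.IsQF := by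
  induction h with
  | matrix h => exact h
  | all _ ih => exact ih
  | ex f _ ih => exact ih

open Classical in
/-- The structure `I` with the function symbol `f` redefined as `φ`. -/
@[reducible] noncomputable def updateFun {M : Type w} {n : ℕ} (I : L.Structure M) (f : L.Functions n)
    (φ : (Fin n → M) → M) : L.Structure M where
  funMap {k} g xs := if h : (⟨k, g⟩ : FunSym L) = ⟨n, f⟩ then
    φ fun i => xs (Fin.cast (congrArg Sigma.fst h).symm i) else I.funMap g xs
  RelMap R xs := I.RelMap R xs

theorem updateFun_funMap_self {M : Type w} {n : ℕ} (I : L.Structure M) (f : L.Functions n)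
    (φ : (Fin n → M) → M) (xs : Fin n → M) : (updateFun I f φ).funMap f xs = φ xs :=
  dif_pos rfl

theorem updateFun_funMap_of_ne {M : Type w} {n k : ℕ} (I : L.Structure M) (f : L.Functions n)
    (φ : (Fin n → M) → M) {g : L.Functions k} (h : (⟨k, g⟩ : FunSym L) ≠ ⟨n, f⟩)
    (xs : Fin k → M) : (updateFun I f φ).funMap g xs = I.funMap g xs :=
  dif_neg h

theorem agreeOff_updateFun {M : Type w} {n : ℕ} (I : L.Structure M) (f : L.Functions n)
    (φ : (Fin n → M) → M) : AgreeOff {(⟨n, f⟩ : FunSym L)} I (updateFun I f φ) :=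
  ⟨fun k g hg xs => (updateFun_funMap_of_ne I f φ (by simpa using hg) xs).symm,
    fun k R xs => Iff.rfl⟩

/-- Skolem functions are chosen one existential quantifier at a time. Universal quantifiers cost
nothing, since truth under all assignments is already the induction hypothesis. -/
theorem Skolemizes.exists_agreeOff {n m : ℕ} {A : Fml L n} {fs : List (FunSym L)} {N : Fml L m}
    (h : Skolemizes A fs N) (hfs : fs.Nodup) (hA : ∀ f ∈ fs, f ∉ A.funs) {M : Type w}
    (I : L.Structure M) (hI : ∀ x, A.Sat I x) :
    ∃ J : L.Structure M, AgreeOff {f | f ∈ fs} I J ∧ ∀ x, N.Sat J x := by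
  induction h generalizing I with
  | matrix h => exact ⟨I, .refl _ I, hI⟩
  | all _ ih =>
    refine ih hfs hA I fun x => ?_
    have := hI (Fin.init (α := fun _ => M) x) (x (Fin.last _))
    rwa [Fin.snoc_init_self] at this
  | @ex n m A fs N f _ ih =>
    rw [List.nodup_cons] at hfs
    -- The choice function φ of the witnesses becomes the interpretation of `f`.
    choose φ hφ using hI
    have hJ := agreeOff_updateFun I f φ
    obtain ⟨J, hJ', hN⟩ := ih hfs.2
      -- The substitution adds only `f` to the symbols of the body, and the remaining Skolem
      -- functions differ from `f`; they are thus still fresh.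
      (fun g hg hgA => by
        have : g ∈ A.funs ∪ {(⟨n, f⟩ : FunSym L)} :=
          Fml.funs_subst_subset A (skolemSubst f) _ Set.subset_union_left
            (fun i => (termFuns_skolemSubst_subset f i).trans Set.subset_union_right) hgA
        rcases this with h | h
        · exact hA g (List.mem_cons_of_mem _ hg) h
        · exact hfs.1 (h ▸ hg))
      (updateFun I f φ)
      (fun x => by
        rw [Fml.sat_subst]
        have key : (fun i => @Term.realize L M (updateFun I f φ) (Fin n) x (skolemSubst f i))
            = Fin.snoc (α := fun _ => M) x (φ x) := by
          funext i
          refine Fin.lastCases ?_ (fun i => ?_) i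
          · simp [skolemSubst, Term.realize, updateFun_funMap_self]
          · simp [skolemSubst]
        -- Redefining `f` does not affect the body, because `f` does not occur in it.
        rw [key, ← Fml.sat_congr hJ]
        · exact hφ x
        · exact Set.disjoint_singleton_right.2 (hA _ List.mem_cons_self))
    exact ⟨J, (hJ.mono (by rintro _ rfl; exact List.mem_cons_self)).trans
      (hJ'.mono fun g hg => List.mem_cons_of_mem _ hg), hN⟩

/-! ## Symbols of clauses -/

/-- The function symbols of a literal. -/
def Lit.funs {α : Type} (A : Lit L α) : Set (FunSym L) := ⋃ i, termFuns (A.args i)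

/-- The function symbols of a clause. -/
def Clause.funs {α : Type} (C : Clause L α) : Set (FunSym L) := ⋃ A ∈ C, Lit.funs A

theorem Lit.funs_subst_subset {α β : Type} [DecidableEq α] (σ : α → L.Term β)
    (K : Set (FunSym L)) (A : Lit L α) (hA : A.funs ⊆ K)
    (hσ : ∀ x ∈ A.vars, termFuns (σ x) ⊆ K) : (A.subst σ).funs ⊆ K := by
  refine Set.iUnion_subset fun i => termFuns_subst_subset_of_vars σ K _
    ((Set.subset_iUnion (fun i => termFuns (A.args i)) i).trans hA) fun x hx => hσ x ?_
  exact Set.mem_iUnion.2 ⟨i, hx⟩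

theorem Lit.funs_subset_subst {α β : Type} (σ : α → L.Term β) (A : Lit L α) :
    A.funs ⊆ (A.subst σ).funs :=
  Set.iUnion_mono fun i => termFuns_subset_subst σ (A.args i)

theorem Clause.funs_subset_iff {α : Type} {C : Clause L α} {K : Set (FunSym L)} :
    C.funs ⊆ K ↔ ∀ A ∈ C, A.funs ⊆ K := Set.iUnion₂_subset_iff

theorem Clause.funs_subst_subset_of_vars {α β : Type} [DecidableEq α] (σ : α → L.Term β)
    (K : Set (FunSym L)) (C : Clause L α) (hC : C.funs ⊆ K)
    (hσ : ∀ x ∈ C.vars, termFuns (σ x) ⊆ K) : (C.subst σ).funs ⊆ K := by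
  rw [Clause.funs_subset_iff] at hC ⊢
  intro B hB
  obtain ⟨A, hA, rfl⟩ := Multiset.mem_map.1 hB
  exact A.funs_subst_subset σ K (hC A hA) fun x hx => hσ x (Set.mem_iUnion₂.2 ⟨A, hA, hx⟩)

theorem Clause.funs_subset_subst {α β : Type} (σ : α → L.Term β) (C : Clause L α) :
    C.funs ⊆ (C.subst σ).funs :=
  Clause.funs_subset_iff.2 fun A hA => (A.funs_subset_subst σ).trans
    (Clause.funs_subset_iff.1 subset_rfl _ (Multiset.mem_map_of_mem _ hA))

theorem Clause.IsInstance.funs_subset {α β : Type} {C : Clause L α} {D : Clause L β}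
    (h : Clause.IsInstance D C) : D.funs ⊆ C.funs := by
  obtain ⟨σ, rfl⟩ := h
  exact D.funs_subset_subst σ

/-- Cutting all terms of σ down to `K` gives another unifier. It factors through σ by generality,
and instantiation never removes symbols, so σ itself has only symbols of `K`. -/
theorem IsMGU.termFuns_subset {σ : ℕ → L.Term ℕ} {A B : Lit L ℕ} (h : IsMGU σ A B)
    {K : Set (FunSym L)} (hA : A.funs ⊆ K) (hB : B.funs ⊆ K) (x : ℕ) : termFuns (σ x) ⊆ K := by
  have key : ∀ E : Lit L ℕ, E.funs ⊆ K → E.subst (fun x => restrictTerm K (.var 0) (σ x)) =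
      ⟨(E.subst σ).pos, (E.subst σ).arity, (E.subst σ).rel,
        fun i => restrictTerm K (.var 0) ((E.subst σ).args i)⟩ := by
    intro E hE
    simp only [Lit.subst, Lit.mk.injEq, heq_eq_eq, true_and]
    funext i
    exact (restrictTerm_subst K _ σ _ (Set.iUnion_subset_iff.1 hE i)).symm
  obtain ⟨δ, hδ⟩ := h.2 (fun x => restrictTerm K (.var 0) (σ x))
    (by rw [key A hA, key B hB, h.1])
  refine (termFuns_subset_subst δ (σ x)).trans ?_
  rw [← hδ x]
  exact termFuns_restrictTerm_subset K _ (Set.empty_subset _) _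

theorem DTree.labels_map {β : Type v} {γ : Type w} (f : β → γ) (T : DTree β) :
    (T.map f).labels = f '' T.labels := by
  induction T with
  | leaf b => simp [DTree.map, DTree.labels]
  | unary b T ih => simp [DTree.map, DTree.labels, ih, Set.image_insert_eq]
  | binary b T U ihT ihU =>
    simp [DTree.map, DTree.labels, ihT, ihU, Set.image_insert_eq, Set.image_union]

theorem DTree.leaves_subset_labels {β : Type v} (T : DTree β) : T.leaves ⊆ T.labels := by
  induction T with
  | leaf b => exact subset_rfl
  | unary b T ih => exact ih.trans Set.subset_union_right
  | binary b T U ihT ihU =>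
    exact Set.union_subset (fun x hx => Or.inl (Or.inr (ihT hx))) (fun x hx => Or.inr (ihU hx))

theorem DTree.root_mem_labels {β : Type v} (T : DTree β) : T.root ∈ T.labels := by
  cases T <;> simp [DTree.root, DTree.labels]

theorem Clause.funs_cons_subset {α : Type} {A : Lit L α} {C : Clause L α} {K : Set (FunSym L)} :
    Clause.funs (A ::ₘ C) ⊆ K ↔ A.funs ⊆ K ∧ C.funs ⊆ K := by
  simp [Clause.funs_subset_iff]

theorem Clause.funs_add_subset {α : Type} {C D : Clause L α} {K : Set (FunSym L)} :
    Clause.funs (C + D) ⊆ K ↔ C.funs ⊆ K ∧ D.funs ⊆ K := by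
  simp [Clause.funs_subset_iff, or_imp, forall_and]

/-- A unifier at an inner node is applied to the whole joined tree, leaves included. The invariant
must therefore cover all labels and not only the root. -/
theorem IsExpansion.funs_subset {X : Set (Clause L ℕ)} {Cs : List (Clause L ℕ)} {i : ℕ}
    {T : DTree (Clause L ℕ)} (h : IsExpansion X Cs i T) {K : Set (FunSym L)}
    (hX : ∀ C ∈ X, Clause.funs C ⊆ K) : ∀ C ∈ T.labels, Clause.funs C ⊆ K := by
  induction h with
  | input _ hE hv =>
    rintro _ rfl
    exact hv.2.funs_subset.trans (hX _ hE)
  | @resolution i j k E C D A B σ T U _ _ _ _ _ _ hT hU hσ _ ihT ihU =>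
    have hA := Clause.funs_cons_subset.1 (hT ▸ ihT _ T.root_mem_labels)
    have hB := Clause.funs_cons_subset.1 (hU ▸ ihU _ U.root_mem_labels)
    have hs := hσ.termFuns_subset hA.1 hB.1
    have hsub : ∀ C : Clause L ℕ, C.funs ⊆ K → (C.subst σ).funs ⊆ K := fun C hC =>
      C.funs_subst_subset_of_vars σ K hC fun x _ => hs x
    simp only [DTree.labels, DTree.labels_map]
    rintro _ ((rfl | ⟨C', hC', rfl⟩) | ⟨C', hC', rfl⟩)
    · exact hsub _ (Clause.funs_add_subset.2 ⟨hA.2, hB.2⟩)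
    · exact hsub _ (ihT _ hC')
    · exact hsub _ (ihU _ hC')
  | @factoring i j E C A B σ T _ _ _ hT hσ _ ihT =>
    have hA := Clause.funs_cons_subset.1 (hT ▸ ihT _ T.root_mem_labels)
    have hB := Clause.funs_cons_subset.1 hA.2
    have hs := hσ.termFuns_subset hA.1 hB.1
    have hsub : ∀ C : Clause L ℕ, C.funs ⊆ K → (C.subst σ).funs ⊆ K := fun C hC =>
      C.funs_subst_subset_of_vars σ K hC fun x _ => hs x
    simp only [DTree.labels, DTree.labels_map]
    rintro _ (rfl | ⟨C', hC', rfl⟩)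
    · exact hsub _ (Clause.funs_cons_subset.2 ⟨hA.1, hB.2⟩)
    · exact hsub _ (ihT _ hC')

theorem DTree.leaves_map {β : Type v} {γ : Type w} (f : β → γ) (T : DTree β) :
    (T.map f).leaves = f '' T.leaves := by
  induction T with
  | leaf b => simp [DTree.map, DTree.leaves]
  | unary b T ih => exact ih
  | binary b T U ihT ihU => simp [DTree.map, DTree.leaves, ihT, ihU, Set.image_union]

theorem IsGroundDeductionFor.funs_subset {X : Set (Clause L ℕ)} {Cs : List (Clause L ℕ)}
    {K : Set (FunSym L)} {Z : Set (Clause L (Fin 0))} {Ds : List (Clause L (Fin 0))}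
    (h : IsGroundDeductionFor X Cs K Z Ds) (hX : ∀ C ∈ X, Clause.funs C ⊆ K) :
    ∀ E ∈ Z, Clause.funs E ⊆ K := by
  obtain ⟨-, T, τ, hT, hτ, rfl, -⟩ := h
  rw [DTree.leaves_map]
  rintro _ ⟨C, hC, rfl⟩
  exact C.funs_subst_subset_of_vars τ K (hT.funs_subset hX _ (T.leaves_subset_labels hC))
    fun x hx => hτ x (Set.mem_iUnion₂.2 ⟨C, T.leaves_subset_labels hC, hx⟩)

theorem ReadsAsClause.funs_eq {n : ℕ} {A : Fml L n} {C : Clause L (Fin n)}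
    (h : ReadsAsClause A C) : A.funs = Clause.funs C := by
  induction h with
  | bot => simp [Fml.funs, Clause.funs]
  | pos R ts => simp [Fml.funs, Clause.funs, Lit.funs]
  | neg R ts => simp [Fml.funs, Clause.funs, Lit.funs]
  | or _ _ ihA ihB =>
    simp only [Fml.funs, ihA, ihB, Clause.funs, Multiset.mem_add, Set.iUnion_or,
      Set.iUnion_union_distrib]

theorem ReadsAsCNF.funs_eq {n : ℕ} {A : Fml L n} {X : Set (Clause L (Fin n))}
    (h : ReadsAsCNF A X) : A.funs = ⋃ C ∈ X, Clause.funs C := by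
  induction h with
  | top => simp [Fml.funs]
  | clause h => simp [h.funs_eq]
  | and _ _ ihA ihB => simp only [Fml.funs, ihA, ihB, Set.biUnion_union]

/-! ## Lifting of ground clauses -/

/-- The predicates of a clause, with the polarities of their occurrences. -/
def Clause.preds {α : Type} (C : Clause L α) : Set (Bool × PredSym L) :=
  ⋃ A ∈ C, {(A.pos, ⟨A.arity, A.rel⟩)}

/-- Truth of a literal. -/
def Lit.Sat {M : Type w} (I : L.Structure M) {α : Type} (A : Lit L α) (x : α → M) : Prop :=
  (A.pos = true) ↔ I.RelMap A.rel fun i => (A.args i).realize x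

theorem ReadsAsClause.preds_eq {n : ℕ} {A : Fml L n} {C : Clause L (Fin n)}
    (h : ReadsAsClause A C) : A.preds = Clause.preds C := by
  unfold Fml.preds
  induction h with
  | bot => simp [Fml.predsAux, Clause.preds]
  | pos R ts => simp [Fml.predsAux, Clause.preds]
  | neg R ts => simp [Fml.predsAux, Clause.preds]
  | or _ _ ihA ihB =>
    simp only [Fml.predsAux, ihA, ihB, Clause.preds, Multiset.mem_add, Set.iUnion_or,
      Set.iUnion_union_distrib]

theorem ReadsAsCNF.preds_eq {n : ℕ} {A : Fml L n} {X : Set (Clause L (Fin n))}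
    (h : ReadsAsCNF A X) : A.preds = ⋃ C ∈ X, Clause.preds C := by
  induction h with
  | top => simp [Fml.preds, Fml.predsAux]
  | clause h => simp [h.preds_eq]
  | and _ _ ihA ihB =>
    unfold Fml.preds at *
    simp only [Fml.predsAux, ihA, ihB, Set.biUnion_union]

theorem ReadsAsClause.sat_iff {n : ℕ} {A : Fml L n} {C : Clause L (Fin n)}
    (h : ReadsAsClause A C) {M : Type w} (I : L.Structure M) (x : Fin n → M) :
    A.Sat I x ↔ ∃ B ∈ C, Lit.Sat I B x := by
  induction h with
  | bot => simp [Fml.Sat]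
  | pos R ts => simp [Fml.Sat, Lit.Sat]
  | neg R ts => simp [Fml.Sat, Lit.Sat]
  | or _ _ ihA ihB => simp only [Fml.Sat, ihA, ihB, Multiset.mem_add, or_and_right, exists_or]

theorem ReadsAsCNF.sat_iff {n : ℕ} {A : Fml L n} {X : Set (Clause L (Fin n))}
    (h : ReadsAsCNF A X) {M : Type w} (I : L.Structure M) (x : Fin n → M) :
    A.Sat I x ↔ ∀ C ∈ X, ∃ B ∈ C, Lit.Sat I B x := by
  induction h with
  | top => simp [Fml.Sat]
  | clause h => simp [h.sat_iff]
  | and _ _ ihA ihB => simp only [Fml.Sat, ihA, ihB, Set.mem_union, or_imp, forall_and]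

theorem ReadsAsClause.isQF {n : ℕ} {A : Fml L n} {C : Clause L (Fin n)}
    (h : ReadsAsClause A C) : A.IsQF := by
  induction h with
  | bot | pos | neg => trivial
  | or _ _ ihA ihB => exact ⟨ihA, ihB⟩

theorem exists_map_eq_add {α : Type u} {β : Type v} {f : α → β} (s : Multiset α)
    {t₁ t₂ : Multiset β} (h : s.map f = t₁ + t₂) :
    ∃ s₁ s₂, s = s₁ + s₂ ∧ s₁.map f = t₁ ∧ s₂.map f = t₂ := by
  induction s, t₁, t₂ using Quotient.inductionOn₃ with
  | _ l l₁ l₂ =>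
    have hperm : (l.map f).Perm (l₁ ++ l₂) := Quotient.exact h
    obtain ⟨l', hl', hl⟩ : ∃ l' : List α, l₁ ++ l₂ = l'.map f ∧ l'.Perm l := by
      have := congrFun (congrFun (List.eq_map_comp_perm f) (l₁ ++ l₂)) l
      exact this.symm.mp hperm.symm
    obtain ⟨r₁, r₂, rfl, rfl, rfl⟩ := List.map_eq_append_iff.1 hl'.symm
    exact ⟨r₁, r₂, Quotient.sound hl.symm, rfl, rfl⟩

/-- The lift follows the disjunction structure of `A`, so that its instance is `A` itself and not
merely a formula with the same literals. At each disjunction, the clause above is split to match the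
two parts of the clause below. -/
theorem ReadsAsClause.exists_lift {n : ℕ} {A : Fml L n} {E : Clause L (Fin n)}
    (h : ReadsAsClause A E) {m : ℕ} (C : Clause L (Fin m)) (σ : Fin m → L.Term (Fin n))
    (hE : E = C.subst σ) : ∃ B : Fml L m, ReadsAsClause B C ∧ B.subst σ = A := by
  induction h generalizing C with
  | bot =>
    obtain rfl := Multiset.map_eq_zero.1 hE.symm
    exact ⟨.bot, .bot, rfl⟩
  | pos R ts =>
    obtain ⟨⟨b, k, R', ts'⟩, rfl, hB⟩ := Multiset.map_eq_singleton.1 hE.symm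
    cases hB
    exact ⟨_, .pos R' ts', rfl⟩
  | neg R ts =>
    obtain ⟨⟨b, k, R', ts'⟩, rfl, hB⟩ := Multiset.map_eq_singleton.1 hE.symm
    cases hB
    exact ⟨_, .neg R' ts', rfl⟩
  | or _ _ ihA ihB =>
    obtain ⟨C₁, C₂, rfl, h₁, h₂⟩ := exists_map_eq_add C hE.symm
    obtain ⟨B₁, hB₁, rfl⟩ := ihA C₁ h₁.symm
    obtain ⟨B₂, hB₂, rfl⟩ := ihB C₂ h₂.symm
    exact ⟨_, hB₁.or hB₂, rfl⟩

/-- The quantifier-free formula `B` holds wherever `N` holds for all assignments, and its symbols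
are among those of `N`. -/
structure IsConsequence {m k : ℕ} (N : Fml L m) (B : Fml L k) : Prop where
  isQF : B.IsQF
  sat : ∀ (M : Type w) (I : L.Structure M), (∀ x, N.Sat I x) → ∀ x, B.Sat I x
  preds : B.preds ⊆ N.preds
  funs : B.funs ⊆ N.funs

/-- The conjunction of two formulas after renaming their variables apart. -/
def Fml.andApart {m k : ℕ} (A : Fml L m) (B : Fml L k) : Fml L (m + k) :=
  .and (A.subst fun i => .var (i.castAdd k)) (B.subst fun i => .var (i.natAdd m))

theorem Fml.andApart_subst {m k n : ℕ} {A : Fml L m} {B : Fml L k} (hA : A.IsQF) (hB : B.IsQF)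
    (θ : Fin m → L.Term (Fin n)) (η : Fin k → L.Term (Fin n)) :
    (A.andApart B).subst (Fin.append θ η) = .and (A.subst θ) (B.subst η) := by
  simp only [Fml.andApart, Fml.subst, hA.subst_subst, hB.subst_subst, Term.subst,
    Fin.append_left, Fin.append_right]

theorem Fml.preds_andApart {m k : ℕ} (A : Fml L m) (B : Fml L k) :
    (A.andApart B).preds = A.preds ∪ B.preds := by
  simp only [Fml.preds, Fml.andApart, Fml.predsAux, Fml.predsAux_subst]

theorem Fml.funs_andApart {m k : ℕ} (A : Fml L m) (B : Fml L k) :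
    (A.andApart B).funs = A.funs ∪ B.funs := by
  simp only [Fml.andApart, Fml.funs, Fml.funs_subst_var]

theorem Fml.sat_andApart {m k : ℕ} (A : Fml L m) (B : Fml L k) {M : Type w}
    (I : L.Structure M) (hA : ∀ x, A.Sat I x) (hB : ∀ x, B.Sat I x) (x : Fin (m + k) → M) :
    (A.andApart B).Sat I x := by
  simp only [Fml.andApart, Fml.Sat, Fml.sat_subst]
  exact ⟨hA _, hB _⟩

/-- Different ground clauses may instantiate the same clause differently, so each conjunct receives
its own block of variables. The values of θ at variables absent from the clause are arbitrary; later
cutting deals with them. -/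
theorem ReadsAsCNF.exists_lift {n m : ℕ} {A : Fml L n} {W : Set (Clause L (Fin n))}
    (h : ReadsAsCNF A W) {N : Fml L m} {Y : Set (Clause L (Fin m))} (hN : ReadsAsCNF N Y)
    (hW : ∀ E ∈ W, ∃ C ∈ Y, Clause.IsInstance C E) :
    ∃ (k : ℕ) (B : Fml L k) (θ : Fin k → L.Term (Fin n)),
      B.subst θ = A ∧ IsConsequence.{u, v, w} N B := by
  induction h with
  | top =>
    exact ⟨0, .top, Fin.elim0, rfl, trivial, fun _ _ _ _ => trivial, Set.empty_subset _,
      Set.empty_subset _⟩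
  | clause h =>
    obtain ⟨C, hC, σ, hE⟩ := hW _ rfl
    obtain ⟨B, hB, rfl⟩ := h.exists_lift C σ hE
    refine ⟨m, B, σ, rfl, hB.isQF, fun M I hI x => ?_, ?_, ?_⟩
    · exact (hB.sat_iff I x).2 ((hN.sat_iff I x).1 (hI x) C hC)
    · rw [hB.preds_eq, hN.preds_eq]
      exact Set.subset_biUnion_of_mem (u := fun C => Clause.preds C) hC
    · rw [hB.funs_eq, hN.funs_eq]
      exact Set.subset_biUnion_of_mem (u := fun C => Clause.funs C) hC
  | and _ _ ihA ihB =>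
    obtain ⟨k₁, B₁, θ₁, rfl, h₁⟩ := ihA fun E hE => hW E (Or.inl hE)
    obtain ⟨k₂, B₂, θ₂, rfl, h₂⟩ := ihB fun E hE => hW E (Or.inr hE)
    refine ⟨k₁ + k₂, B₁.andApart B₂, Fin.append θ₁ θ₂,
      Fml.andApart_subst h₁.isQF h₂.isQF _ _, ⟨h₁.isQF.subst _, h₂.isQF.subst _⟩,
      fun M I hI x => ?_, ?_, ?_⟩
    · exact Fml.sat_andApart B₁ B₂ I (h₁.sat M I hI) (h₂.sat M I hI) x
    · rw [Fml.preds_andApart]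
      exact Set.union_subset h₁.preds h₂.preds
    · rw [Fml.funs_andApart]
      exact Set.union_subset h₁.funs h₂.funs

/-! ### Padding by valid formulas, and the expansion formulas -/

/-- Some predicate of positive arity occurs in the formula. -/
def Fml.HasTerms {n : ℕ} (A : Fml L n) : Prop :=
  ∃ (b : Bool) (k : ℕ) (R : L.Relations (k + 1)), (b, (⟨k + 1, R⟩ : PredSym L)) ∈ A.preds

/-- A valid formula with given function symbols. -/
theorem exists_valid_funs_eq {P : Set (Bool × PredSym L)} {b : Bool} {k : ℕ}
    {R : L.Relations (k + 1)} (hR : (b, (⟨k + 1, R⟩ : PredSym L)) ∈ P) {S : Set (FunSym L)}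
    (hS : S.Finite) : ∃ D : Fml L 1, D.IsQF ∧ D.preds ⊆ P ∧ D.funs = S ∧
      ∀ (M : Type w) (I : L.Structure M) (x : Fin 1 → M), D.Sat I x := by
  induction S, hS using Set.Finite.induction_on with
  | empty => exact ⟨.top, trivial, Set.empty_subset _, rfl, fun _ _ _ => trivial⟩
  | @insert f S _ _ ih =>
    obtain ⟨D, hQF, hP, hS, hD⟩ := ih
    obtain ⟨l, f⟩ := f
    -- All arguments of `f` are a variable, so that no other symbol enters. At least one argument
    -- place of `R` exists to hold the term.
    let A : Fml L 1 := .atom R fun _ => .func f fun _ => .var 0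
    have hA : A.funs = {(⟨l, f⟩ : FunSym L)} := by simp [A, Fml.funs, termFuns]
    cases b with
    | true =>
      refine ⟨.or A D, ⟨trivial, hQF⟩, Set.union_subset (by rintro _ rfl; exact hR) hP, ?_,
        fun M I x => Or.inr (hD M I x)⟩
      rw [Fml.funs, hA, hS, Set.singleton_union]
    | false =>
      refine ⟨.or (.neg A) D, ⟨trivial, hQF⟩, Set.union_subset (by rintro _ rfl; exact hR) hP, ?_,
        fun M I x => Or.inr (hD M I x)⟩
      rw [Fml.funs, Fml.funs, hA, hS, Set.singleton_union]

/-- Without a predicate of positive arity nothing can be mentioned, and `⊤` is taken instead. -/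
theorem exists_valid {n : ℕ} (A : Fml L n) {S : Set (FunSym L)} (hS : S.Finite) :
    ∃ D : Fml L 1, D.IsQF ∧ D.preds ⊆ A.preds ∧ D.funs ⊆ S ∧ (A.HasTerms → S ⊆ D.funs) ∧
      ∀ (M : Type w) (I : L.Structure M) (x : Fin 1 → M), D.Sat I x := by
  by_cases h : A.HasTerms
  · obtain ⟨b, k, R, hR⟩ := h
    obtain ⟨D, hQF, hP, rfl, hD⟩ := exists_valid_funs_eq.{u, v, w} hR hS
    exact ⟨D, hQF, hP, subset_rfl, fun _ => subset_rfl, hD⟩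
  · exact ⟨.top, trivial, Set.empty_subset _, Set.empty_subset _, fun h' => (h h').elim,
      fun _ _ _ => trivial⟩

/-- The clausal form `X` of a sentence has formulas that express it up to Skolem functions. -/
theorem IsClausalForm.exists_matrix {A : Fml L 0} {fs : List (FunSym L)} {X : Set (Clause L ℕ)}
    (h : IsClausalForm A fs X) (hfs : fs.Nodup) (hA : ∀ f ∈ fs, f ∉ A.funs) :
    ∃ (m : ℕ) (N : Fml L m) (Y : Set (Clause L (Fin m))), ReadsAsCNF N Y ∧
      X = Clause.subst (fun i : Fin m => .var (i : ℕ)) '' Y ∧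
      N.preds ⊆ A.preds ∧ N.funs ⊆ A.funs ∪ {f | f ∈ fs} ∧
      ∀ (M : Type w) [Nonempty M] (I : L.Structure M), A.Sat I Fin.elim0 →
        ∃ J : L.Structure M, AgreeOff {f | f ∈ fs} I J ∧ ∀ x, N.Sat J x := by
  obtain ⟨P, m, N', N, Y, hP, hsk, hN, hY, hX⟩ := h
  have hP' := Rewrites.refines (fun h => PrenexRule.refines.{u, v, w} h) hP
  have hN' := Rewrites.refines (fun h => PropRule.refines.{u, v, w} h) hN
  refine ⟨m, N, Y, hY, hX, (hN'.preds true).trans (hsk.preds_eq.subset.trans (hP'.preds true)),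
    hN'.funs.trans (hsk.funs_subset.trans (Set.union_subset_union_left _ hP'.funs)),
    fun M _ I hI => ?_⟩
  obtain ⟨J, hJ, hsat⟩ := hsk.exists_agreeOff hfs (fun f hf h => hA f hf (hP'.funs h)) I
    (fun x => by rw [Subsingleton.elim x Fin.elim0]; exact (hP'.sat M I _).2 hI)
  exact ⟨J, hJ, fun x => (hN'.sat M J x).2 (hsat x)⟩

theorem Clause.funs_subset_of_isClausalForm {m : ℕ} {N : Fml L m} {Y : Set (Clause L (Fin m))}
    (hN : ReadsAsCNF N Y) (C : Clause L ℕ)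
    (hC : C ∈ Clause.subst (fun i : Fin m => (.var (i : ℕ) : L.Term ℕ)) '' Y) :
    Clause.funs C ⊆ N.funs := by
  obtain ⟨C, hC, rfl⟩ := hC
  refine C.funs_subst_subset_of_vars _ _ ?_ fun x _ => Set.empty_subset _
  rw [hN.funs_eq]
  exact Set.subset_biUnion_of_mem (u := fun C => Clause.funs C) hC

theorem Clause.IsInstance.of_rename {m n : ℕ} {C : Clause L (Fin m)} {E : Clause L (Fin n)}
    (h : Clause.IsInstance (C.subst fun i : Fin m => (.var (i : ℕ) : L.Term ℕ)) E) :
    Clause.IsInstance C E := by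
  obtain ⟨σ, rfl⟩ := h
  refine ⟨fun i => σ i, ?_⟩
  simp only [Clause.subst, Multiset.map_map]
  refine Multiset.map_congr rfl fun A _ => ?_
  simp only [Function.comp_apply, Lit.subst, subst_subst, Term.subst]

/-- A formula `B` that lifts the ground formula `Agrd`, extended by a valid formula such that all
function symbols in `S` occur, unless no terms occur in `A`. -/
theorem IsClausalForm.exists_expansion {A : Fml L 0} {fs : List (FunSym L)}
    {X : Set (Clause L ℕ)} (h : IsClausalForm A fs X) (hfs : fs.Nodup)
    (hA : ∀ f ∈ fs, f ∉ A.funs) {S : Set (FunSym L)} (hS : S.Finite)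
    (hAS : A.funs ∪ {f | f ∈ fs} ⊆ S) {Agrd : Fml L 0} {W : Set (Clause L (Fin 0))}
    (hAgrd : ReadsAsCNF Agrd W) (hW : ∀ E ∈ W, ∃ C ∈ X, Clause.IsInstance C E)
    (c : L.Functions 0) :
    (∀ C ∈ X, Clause.funs C ⊆ S) ∧
    ∃ (k : ℕ) (B : Fml L k) (θ : Fin k → L.Term (Fin 0)), B.IsQF ∧
      (∀ (M : Type w) [Nonempty M] (I : L.Structure M), A.Sat I Fin.elim0 →
        SatExAll I {f | f ∈ fs} B) ∧
      B.preds ⊆ A.preds ∧ Agrd.preds ⊆ B.preds ∧ B.funs ⊆ S ∧ (A.HasTerms → S ⊆ B.funs) ∧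
      (∀ (M : Type w) (I : L.Structure M) (x : Fin 0 → M),
        (B.subst θ).Sat I x ↔ Agrd.Sat I x) ∧
      Agrd.funs ⊆ (B.subst θ).funs ∧
      (B.subst θ).funs ⊆ Agrd.funs ∪ S ∪ {⟨0, c⟩} := by
  obtain ⟨m, N, Y, hNY, hX, hNp, hNf, hNs⟩ :=
    IsClausalForm.exists_matrix.{u, v, w} h hfs hA
  refine ⟨fun C hC => (Clause.funs_subset_of_isClausalForm hNY C (hX ▸ hC)).trans
    (hNf.trans hAS), ?_⟩
  obtain ⟨k, B, θ, rfl, hB⟩ := ReadsAsCNF.exists_lift.{u, v, w} hAgrd hNY fun E hE => by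
    obtain ⟨C, hC, hCE⟩ := hW E hE
    rw [hX] at hC
    obtain ⟨C, hC, rfl⟩ := hC
    exact ⟨C, hC, hCE.of_rename⟩
  obtain ⟨D, hDQ, hDp, hDf, hDS, hDs⟩ := exists_valid.{u, v, w} A hS
  -- The variable of the padding is grounded by `c`. It cannot be `c` from the outset, since `c` may
  -- belong to the other side and is then not permitted in this expansion.
  have hsub := Fml.andApart_subst hB.isQF hDQ θ fun _ => .func c Fin.elim0
  refine ⟨k + 1, B.andApart D, Fin.append θ fun _ => .func c Fin.elim0,
    ⟨hB.isQF.subst _, hDQ.subst _⟩, fun M _ I hI => ?_, ?_, ?_, ?_, ?_, ?_, ?_, ?_⟩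
  · obtain ⟨J, hJ, hNJ⟩ := hNs M I hI
    exact ⟨J, hJ, Fml.sat_andApart B D J (hB.sat M J hNJ) (hDs M J)⟩
  · rw [Fml.preds_andApart]
    exact Set.union_subset (hB.preds.trans hNp) hDp
  · rw [Fml.preds_andApart, Fml.preds_subst]
    exact Set.subset_union_left
  · rw [Fml.funs_andApart]
    exact Set.union_subset (hB.funs.trans (hNf.trans hAS)) hDf
  · rw [Fml.funs_andApart]
    exact fun h => (hDS h).trans Set.subset_union_right
  · intro M I x
    rw [hsub]
    simp only [Fml.Sat, Fml.sat_subst I D, hDs, and_true]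
  · rw [hsub]
    exact Set.subset_union_left
  · rw [hsub]
    refine Set.union_subset (fun f hf => Or.inl (Or.inl hf)) ?_
    refine Fml.funs_subst_subset _ _ _ (fun f hf => Or.inl (Or.inr (hDf hf))) fun i => ?_
    simp [termFuns]

/-- The separation properties of the two sets of symbols of an interpolant lifting base. -/
theorem AreLiftingSymbols.properties {F G : Fml L 0} {fs gs : List (FunSym L)}
    {S T : Set (FunSym L)} (h : AreLiftingSymbols F G fs gs S T) (hdistinct : (fs ++ gs).Nodup)
    (hfresh : ∀ f ∈ fs ++ gs, f ∉ F.funs ∪ G.funs) :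
    S.Finite ∧ T.Finite ∧ Disjoint S T ∧ F.funs ∩ T = ∅ ∧ G.funs ∩ S = ∅ ∧
      {f | f ∈ fs} ∪ (F.funs \ G.funs) ⊆ S ∧ {g | g ∈ gs} ∪ (G.funs \ F.funs) ⊆ T ∧
      HasConst (S ∪ T ∪ (F.funs ∩ G.funs)) := by
  have hd := List.disjoint_of_nodup_append hdistinct
  have hF : ∀ f ∈ fs, f ∉ F.funs ∧ f ∉ G.funs := fun f hf => by
    simpa using hfresh f (List.mem_append_left _ hf)
  have hG : ∀ f ∈ gs, f ∉ F.funs ∧ f ∉ G.funs := fun f hf => by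
    simpa using hfresh f (List.mem_append_right _ hf)
  have hS₀ : ({f | f ∈ fs} ∪ (F.funs \ G.funs)).Finite :=
    (List.finite_toSet fs).union (F.funs_finite.subset Set.sdiff_subset)
  have hT₀ : ({g | g ∈ gs} ∪ (G.funs \ F.funs)).Finite :=
    (List.finite_toSet gs).union (G.funs_finite.subset Set.sdiff_subset)
  have hST₀ : Disjoint ({f | f ∈ fs} ∪ (F.funs \ G.funs)) ({g | g ∈ gs} ∪ (G.funs \ F.funs)) := by
    rw [Set.disjoint_left]
    rintro f (hf | hf) (hg | hg)
    · exact hd hf hg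
    · exact (hF f hf).2 hg.1
    · exact (hG f hg).1 hf.1
    · exact hf.2 hg.1
  have hFT₀ : F.funs ∩ ({g | g ∈ gs} ∪ (G.funs \ F.funs)) = ∅ := by
    refine Set.eq_empty_of_forall_notMem ?_
    rintro f ⟨hf, hg | hg⟩
    · exact (hG f hg).1 hf
    · exact hg.2 hf
  have hGS₀ : G.funs ∩ ({f | f ∈ fs} ∪ (F.funs \ G.funs)) = ∅ := by
    refine Set.eq_empty_of_forall_notMem ?_
    rintro f ⟨hg, hf | hf⟩
    · exact (hF f hf).2 hg
    · exact hf.2 hg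
  rcases h with ⟨hc, rfl, rfl⟩ | ⟨hc, c, h⟩
  · exact ⟨hS₀, hT₀, hST₀, hFT₀, hGS₀, subset_rfl, subset_rfl, hc⟩
  · have hcS : (⟨0, c⟩ : FunSym L) ∉ {f | f ∈ fs} ∪ (F.funs \ G.funs) :=
      fun h => hc ⟨c, Or.inl (Or.inl h)⟩
    have hcT : (⟨0, c⟩ : FunSym L) ∉ {g | g ∈ gs} ∪ (G.funs \ F.funs) :=
      fun h => hc ⟨c, Or.inl (Or.inr h)⟩
    have hcFG : (⟨0, c⟩ : FunSym L) ∉ F.funs ∩ G.funs := fun h => hc ⟨c, Or.inr h⟩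
    -- The added constant is new to `F` and `G`: their symbols all lie in `S₀`, `T₀` or the shared
    -- part, and none of these contains a constant.
    have hcF : (⟨0, c⟩ : FunSym L) ∉ F.funs :=
      fun h => hcS (Or.inr ⟨h, fun h' => hcFG ⟨h, h'⟩⟩)
    have hcG : (⟨0, c⟩ : FunSym L) ∉ G.funs :=
      fun h => hcT (Or.inr ⟨h, fun h' => hcFG ⟨h', h⟩⟩)
    rcases h with ⟨rfl, rfl⟩ | ⟨rfl, rfl⟩
    · refine ⟨hS₀.insert _, hT₀, Set.disjoint_insert_left.2 ⟨hcT, hST₀⟩, hFT₀, ?_,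
        Set.subset_insert _ _, subset_rfl, c, Or.inl (Or.inl (Set.mem_insert _ _))⟩
      rw [Set.inter_insert_of_notMem hcG, hGS₀]
    · refine ⟨hS₀, hT₀.insert _, Set.disjoint_insert_right.2 ⟨hcS, hST₀⟩, ?_, hGS₀,
        subset_rfl, Set.subset_insert _ _, c, Or.inl (Or.inr (Set.mem_insert _ _))⟩
      rw [Set.inter_insert_of_notMem hcF, hFT₀]

theorem Fml.hasTerms_of_mem_funs {n m : ℕ} {A : Fml L n} {B : Fml L m} {f : FunSym L}
    (hf : f ∈ A.funs) (hAB : A.preds ⊆ B.preds) : B.HasTerms := by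
  obtain ⟨b, k, R, h⟩ := A.exists_pred_of_mem_funs hf true
  exact ⟨b, k, R, hAB h⟩

theorem Fml.preds_neg_subset {n m : ℕ} {A : Fml L n} {B : Fml L m} (h : A.preds ⊆ B.preds) :
    (Fml.neg A).preds ⊆ (Fml.neg B).preds := by
  rintro ⟨b, p⟩ hp
  rw [Fml.mem_preds_neg] at hp ⊢
  exact h hp

theorem Fml.preds_neg_neg {n : ℕ} (A : Fml L n) : (Fml.neg (Fml.neg A)).preds = A.preds := by
  simp only [Fml.preds, Fml.predsAux, Bool.not_not]

end CraigLifting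

/-! ### The main theorem -/

open CraigLifting
theorem mainTheorem6 {L : FirstOrder.Language.{u, v}}
    (F G : Fml L 0) (hFG : Fml.Entails.{u, v, w} F G)
    -- the clausal forms `F'` of `F` and `G'` of `¬ G`, with fresh Skolem functions `fs` and `gs`
    (fs gs : List (FunSym L)) (F' G' : Set (Clause L ℕ))
    (hF' : IsClausalForm F fs F') (hG' : IsClausalForm (.neg G) gs G')
    (hdistinct : (fs ++ gs).Nodup)
    (hfresh : ∀ f ∈ fs ++ gs, f ∉ F.funs ∪ G.funs)
    -- the sets of symbols
    (symsF symsG : Set (FunSym L)) (hsyms : AreLiftingSymbols F G fs gs symsF symsG)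
    -- the resolution proof and the ground resolution proof for it
    (D : List (Clause L ℕ)) (hD : IsRefutation ResRule (F' ∪ G') D)
    (Z : Set (Clause L (Fin 0))) (Dgrd : List (Clause L (Fin 0)))
    (hDgrd : IsRefutation GrdRule Z Dgrd)
    (hfor : IsGroundDeductionFor (F' ∪ G') D (symsF ∪ symsG ∪ (F.funs ∩ G.funs)) Z Dgrd)
    -- CNF formulas for the two sets of ground input clauses, and the ground interpolant
    (Fgrd Ggrd Hgrd : Fml L 0)
    (hFgrd : ReadsAsCNF Fgrd (inputInstances F' Z Dgrd))
    (hGgrd : ReadsAsCNF Ggrd (inputInstances G' Z Dgrd))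
    (hground : Hgrd.IsQF)
    (hH : IsCraigLyndon.{u, v, w} Fgrd (.neg Ggrd) Hgrd) :
    IsLiftingBase.{u, v, w} F G symsF symsG Hgrd := by
  obtain ⟨hSfin, hTfin, hST, hFT, hGS, hS, hT, c, hc⟩ :=
    hsyms.properties hdistinct hfresh
  rw [Set.union_subset_iff] at hS hT
  obtain ⟨hfsnd, hgsnd, -⟩ := List.nodup_append.1 hdistinct
  have hFS : F.funs ∪ {f | f ∈ fs} ⊆ F.funs ∩ G.funs ∪ symsF := by
    refine Set.union_subset (fun f hf => ?_) (hS.1.trans Set.subset_union_right)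
    by_cases hg : f ∈ G.funs
    · exact Or.inl ⟨hf, hg⟩
    · exact Or.inr (hS.2 ⟨hf, hg⟩)
  have hGT : (Fml.neg G).funs ∪ {g | g ∈ gs} ⊆ F.funs ∩ G.funs ∪ symsG := by
    refine Set.union_subset (fun f hg => ?_) (hT.1.trans Set.subset_union_right)
    by_cases hf : f ∈ F.funs
    · exact Or.inl ⟨hf, hg⟩
    · exact Or.inr (hT.2 ⟨hg, hf⟩)
  have hfin : (F.funs ∩ G.funs).Finite := F.funs_finite.subset Set.inter_subset_left
  obtain ⟨hF'funs, m, A, θ, hAQ, hAsat, hAp, hAp', hAf, hAt, hAθ, hAθf, hAθf'⟩ :=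
    IsClausalForm.exists_expansion.{u, v, w} hF' hfsnd
      (fun f hf h => hfresh f (List.mem_append_left _ hf) (Or.inl h))
      (hfin.union hSfin) hFS hFgrd (fun E hE => hE.2.2) c
  obtain ⟨hG'funs, k, B, η, hBQ, hBsat, hBp, hBp', hBf, hBt, hBη, hBηf, hBηf'⟩ :=
    IsClausalForm.exists_expansion.{u, v, w} hG' hgsnd
      (fun f hf h => hfresh f (List.mem_append_right _ hf) (Or.inr h))
      (hfin.union hTfin) hGT hGgrd (fun E hE => hE.2.2) c
  set U := symsF ∪ symsG ∪ (F.funs ∩ G.funs) with hU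
  have hSU : F.funs ∩ G.funs ∪ symsF ⊆ U :=
    Set.union_subset Set.subset_union_right fun f hf => Or.inl (Or.inl hf)
  have hTU : F.funs ∩ G.funs ∪ symsG ⊆ U :=
    Set.union_subset Set.subset_union_right fun f hf => Or.inl (Or.inr hf)
  have hZ : ∀ E ∈ Z, Clause.funs E ⊆ U := hfor.funs_subset fun C hC =>
    hC.elim (fun hC => (hF'funs C hC).trans hSU) fun hC => (hG'funs C hC).trans hTU
  have hFgU : Fgrd.funs ⊆ U := by
    rw [hFgrd.funs_eq]
    exact Set.iUnion₂_subset fun E hE => hZ E hE.2.1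
  have hGgU : Ggrd.funs ⊆ U := by
    rw [hGgrd.funs_eq]
    exact Set.iUnion₂_subset fun E hE => hZ E hE.2.1
  -- The optional constant is `c` if `c` is not shared by `F` and `G`. A shared `c` needs no
  -- exemption, because then `F` contains terms and the padding mentions `c`.
  let Cs : Set (L.Functions 0) := {d | d = c ∧ (⟨0, d⟩ : FunSym L) ∈ symsF ∪ symsG}
  let K : Set (FunSym L) := A.funs ∪ B.funs ∪ (fun d => (⟨0, d⟩ : FunSym L)) '' Cs
  have hAK : A.funs ⊆ K := fun f hf => Or.inl (Or.inl hf)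
  have hBK : B.funs ⊆ K := fun f hf => Or.inl (Or.inr hf)
  let t : L.Term (Fin 0) := .func c Fin.elim0
  have hcK : (⟨0, c⟩ : FunSym L) ∈ K := by
    rcases hc with hc | hc
    · exact Or.inr ⟨c, ⟨rfl, hc⟩, rfl⟩
    · exact hAK (hAt (Fml.hasTerms_of_mem_funs hc.1 subset_rfl) (Or.inl hc))
  have htK : termFuns t ⊆ K := by simpa [t, termFuns] using hcK
  have hHpF : Hgrd.preds ⊆ F.preds := fun p hp => hAp (hAp' (hH.preds hp).1)
  have hHpG : Hgrd.preds ⊆ (Fml.neg B).preds :=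
    fun p hp => Fml.preds_neg_subset hBp' (hH.preds hp).2
  have hBpG : (Fml.neg B).preds ⊆ G.preds :=
    (Fml.preds_neg_subset hBp).trans (Fml.preds_neg_neg G).subset
  -- A function symbol in the interpolant forces a predicate of positive arity into both `F` and
  -- `G`. Both paddings then exist and together mention every symbol of `U`.
  have hall : Hgrd.funs.Nonempty → U ⊆ K := by
    rintro ⟨f, hf⟩
    have hFt : F.HasTerms := Fml.hasTerms_of_mem_funs hf hHpF
    have hGt : (Fml.neg G).HasTerms := by
      obtain ⟨b, k, R, hR⟩ := Fml.hasTerms_of_mem_funs hf (hHpG.trans hBpG)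
      exact ⟨!b, k, R, by rwa [Fml.mem_preds_neg, Bool.not_not]⟩
    rintro g ((hg | hg) | hg)
    · exact hAK (hAt hFt (Or.inr hg))
    · exact hBK (hBt hGt (Or.inr hg))
    · exact hAK (hAt hFt (Or.inl hg))
  have hHK : Hgrd.funs ⊆ K := fun f hf => hall ⟨f, hf⟩ (hFgU (hH.funs hf).1)
  -- The entailment from `Fgrd` is applied in the structure with all functions outside `K` made
  -- constant. The interpolant cannot distinguish this structure from `I`.
  have hleft : Fml.Entails.{u, v, w} (A.subst fun i => restrictTerm K t (θ i)) Hgrd := by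
    intro M _ I x hI
    rw [Fml.sat_subst_restrictTerm I A K hAK, hAθ] at hI
    exact (Fml.sat_congr (agreeOff_restrictStructure K _ I) Hgrd
      (Set.disjoint_compl_right_iff_subset.2 hHK) x).2 (hH.left M _ x hI)
  have hright : Fml.Entails.{u, v, w} Hgrd
      ((Fml.neg B).subst fun i => restrictTerm K t (η i)) := by
    intro M _ I x hI hB
    rw [Fml.sat_subst_restrictTerm I B K hBK, hBη] at hB
    exact hH.right M _ x ((Fml.sat_congr (agreeOff_restrictStructure K (t.realize x) I) Hgrd
      (Set.disjoint_compl_right_iff_subset.2 hHK) x).1 hI) hB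
  refine ⟨hSfin, hTfin, hST, hground, m, k, A, .neg B, fun i => restrictTerm K t (θ i),
    fun i => restrictTerm K t (η i), hAQ, hBQ, fun M _ I hI => ?_, fun M _ I hI => ?_, hAp, hBpG,
    hAf, hBf, hFT, hGS, ⟨Cs, ?_, fun d hd => hd.2, ?_⟩, ⟨?_, hleft, hright, ?_, ?_, ?_⟩⟩
  · obtain ⟨J, hJ, hA⟩ := hAsat M I hI
    exact ⟨J, hJ.mono hS.1, hA⟩
  -- `B` expands `¬ G`, so this is the contrapositive of the Skolemization statement: a failure of
  -- `G` yields an interpretation of the Skolem functions in which `B` holds for all assignments.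
  · by_contra hnG
    obtain ⟨J, hJ, hB⟩ := hBsat M I hnG
    obtain ⟨x, hx⟩ := hI J (hJ.mono hT.1)
    exact hx (hB x)
  · rintro d ⟨rfl, -⟩ e ⟨rfl, -⟩
    rfl
  · exact Set.union_subset
      (Set.iUnion_subset fun i => termFuns_restrictTerm_subset K t htK (θ i))
      (Set.iUnion_subset fun i => termFuns_restrictTerm_subset K t htK (η i))
  · exact fun M _ I x hI => hright M I x (hleft M I x hI)
  · rw [Fml.preds_subst, Fml.preds_subst]
    exact fun p hp => ⟨hAp' (hH.preds hp).1, hHpG hp⟩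
  -- As the interpolant contains `f`, all of `U` is permitted. Both uncut instances have symbols in
  -- `U`, so cutting leaves them unchanged, and they still contain the symbols of `Fgrd` and `Ggrd`.
  · intro f hf
    have hUK := hall ⟨f, hf⟩
    have hcU : {(⟨0, c⟩ : FunSym L)} ⊆ U := Set.singleton_subset_iff.2 hc
    have hA := hAQ.subst_restrictTerm_eq K t θ
      ((hAθf'.trans (Set.union_subset (Set.union_subset hFgU hSU) hcU)).trans hUK)
    have hB := hBQ.subst_restrictTerm_eq K t η
      ((hBηf'.trans (Set.union_subset (Set.union_subset hGgU hTU) hcU)).trans hUK)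
    rw [Fml.subst, hA, hB]
    exact ⟨hAθf (hH.funs hf).1, hBηf (hH.funs hf).2⟩
  · exact fun i => i.elim0
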